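/- Let $\alpha\in\mathbb R$, $\alpha\neq 0$, let $\vec a\in\mathbb R^3$ be a unit vector, and let $\mathbb R^3_+(\vec a)=\{q\in\mathbb R^3:\langle q,\vec a\rangle>0\}$. For a smooth immersion $\phi:M\to\mathbb R^3_+(\vec a)$ of a surface $M$ and a unit normal $N$ of $\phi$, let $H$ be the mean curvature of $\phi$ with respect to $N$ (half the sum of the principal curvatures, so that the unit sphere has $H=1$ for the inward normal), and let $$H_\varphi=H-\alpha\,\frac{\langle N,\vec a\rangle}{2\langle\phi,\vec a\rangle}$$ be the weighted mean curvature, that is, the one for the density $e^{\varphi(q)}=\langle q,\vec a\rangle^\alpha$. The immersion $\phi$ is called an $\alpha$-singular minimal surface if $2H=\alpha\langle N,\vec a\rangle/\langle\phi,\vec a\rangle$ on $M$, i.e. $H_\varphi=0$ (this does not depend on the choice of the unit normal). **Proposition 2.5.** There is no closed surface with constant weighted mean curvature: if $M$ is a non-empty compact smooth surface without boundary, then there do not exist a smooth immersion $\phi:M\to\mathbb R^3_+(\vec a)$, a continuous unit normal vector field (Gauss map) $N$ along $\phi$, and a constant $c\in\mathbb R$ such that $H_\varphi=c$ on $M$.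 In particular, every compact singular minimal surface has non-empty boundary: if $M$ is a non-empty compact smooth surface with (possibly empty) boundary and $\phi:M\to\mathbb R^3_+(\vec a)$ is an $\alpha$-singular minimal surface, then $\partial M\neq\emptyset$. -/

import Mathlib

open scoped Manifold ContDiff

noncomputable section

namespace WeightedSurface

/-- The Euclidean plane, the model vector space of surfaces. -/
abbrev Plane : Type := EuclideanSpace ℝ (Fin 2)

/-- Euclidean three-dimensional space. -/
abbrev Space : Type := EuclideanSpace ℝ (Fin 3)

section

variable {H : Type*} [TopologicalSpace H] (I : ModelWithCorners ℝ Plane H)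
  {M : Type*} [TopologicalSpace M] [ChartedSpace H M]

/-- The differential `df_p : T_p M → ℝ³`. -/
def differential (f : M → Space) (p : M) : Plane →L[ℝ] Space :=
  mfderiv I 𝓘(ℝ, Space) f p

/-- `f : M → ℝ³` is a smooth immersion of the surface `M` (possibly with boundary) whose image lies
in the open half-space `{q | 0 < ⟪q, a⟫}`. -/
structure IsImmersionInHalfSpace (a : Space) (f : M → Space) : Prop where
  contMDiff : ContMDiff I 𝓘(ℝ, Space) ∞ f
  injective_differential : ∀ p : M, Function.Injective (differential I f p)
  height_pos : ∀ p : M, 0 < inner ℝ (f p) a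

/-- `ν` is a unit vector orthogonal to the tangent plane of `f` at `p`. -/
structure IsUnitNormalAt (f : M → Space) (p : M) (ν : Space) : Prop where
  norm_eq_one : ‖ν‖ = 1
  orthogonal : ∀ v : Plane, inner ℝ (differential I f p v) ν = 0

/-- `N` is a Gauss map of the immersion `f`: a continuous unit normal vector field along `f`.
Choosing `N` is the same as choosing an orientation of the immersed surface. -/
structure IsGaussMap (f : M → Space) (N : M → Space) : Prop where
  continuous : Continuous N
  isUnitNormalAt : ∀ p : M, IsUnitNormalAt I f p (N p)

/-- The local parametrization `f ∘ x⁻¹`, where `x` is the preferred chart at `p`. It is relevant on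
`Set.range I` only (the whole plane, or a half-plane for surfaces with boundary). -/
def localParam (f : M → Space) (p : M) : Plane → Space :=
  f ∘ (extChartAt I p).symm

/-- The partial derivative `∂ᵢ X` of the local parametrization `X` at `p`, as a function of the
coordinates. -/
def partialDeriv (f : M → Space) (p : M) (i : Fin 2) (u : Plane) : Space :=
  fderivWithin ℝ (localParam I f p) (Set.range I) u (EuclideanSpace.single i 1)

/-- The second partial derivative `∂ⱼ ∂ᵢ X` at the point `p` itself. -/
def partialDeriv₂ (f : M → Space) (p : M) (i j : Fin 2) : Space :=
  fderivWithin ℝ (partialDeriv I f p i) (Set.range I) (extChartAt I p p)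
    (EuclideanSpace.single j 1)

/-- The first fundamental form `gᵢⱼ = ⟪∂ᵢ X, ∂ⱼ X⟫` at `p`. -/
def firstForm (f : M → Space) (p : M) : Matrix (Fin 2) (Fin 2) ℝ :=
  Matrix.of fun i j =>
    inner ℝ (partialDeriv I f p i (extChartAt I p p)) (partialDeriv I f p j (extChartAt I p p))

/-- The second fundamental form `hᵢⱼ = ⟪∂ⱼ ∂ᵢ X, ν⟫` at `p`, with respect to the unit normal `ν`. -/
def secondForm (f : M → Space) (p : M) (ν : Space) : Matrix (Fin 2) (Fin 2) ℝ :=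
  Matrix.of fun i j => inner ℝ (partialDeriv₂ I f p i j) ν

/-- The mean curvature `H = (κ₁ + κ₂) / 2` at `p` with respect to the unit normal `ν`: half the
trace of the shape operator `g⁻¹ h`. The unit sphere has `H = 1` for the inward normal. -/
def meanCurvature (f : M → Space) (p : M) (ν : Space) : ℝ :=
  ((firstForm I f p)⁻¹ * secondForm I f p ν).trace / 2

/-- The weighted mean curvature for the density `⟪q, a⟫ ^ α`, that is
`H - α ⟪ν, a⟫ / (2 ⟪f, a⟫)`. -/
def weightedMeanCurvature (α : ℝ) (a : Space) (f : M → Space) (p : M) (ν : Space) : ℝ :=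
  meanCurvature I f p ν - α * inner ℝ ν a / (2 * inner ℝ (f p) a)

/-- `f` is an `α`-singular minimal surface with density vector `a`: an immersion in the half-space
with `2 H = α ⟪ν, a⟫ / ⟪f, a⟫` everywhere. Both sides change sign with `ν`, so the equation
does not depend on the choice of the unit normal and no orientation of `M` is involved. -/
structure IsSingularMinimal (α : ℝ) (a : Space) (f : M → Space) : Prop where
  isImmersion : IsImmersionInHalfSpace I a f
  equation : ∀ (p : M) (ν : Space), IsUnitNormalAt I f p ν →
    2 * meanCurvature I f p ν = α * inner ℝ ν a / inner ℝ (f p) a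

end

end WeightedSurface

end

/-! Write J dA-style quantities in charts, with J = det(∂₁X, ∂₂X, N). For a fixed vector a, the
ℝ³-valued function a × (N + c f) satisfies ∑ₖ d(a × (N + c f))ₖ ∧ dfₖ = 2 (c - H) ⟨N, a⟩ dA: the N
term gives -2H ⟨N, a⟩ by the Weingarten equations, and the f term gives 2c ⟨N, a⟩. If H_φ = c, this
equals -(α ⟨N, a⟩² / ⟨f, a⟩) dA (`sum_wedge_eq_of_weightedMeanCurvature_eq`). The left side is
exact, so its integral over a closed surface is zero (`sum_setIntegral_wedge_eq_zero`). The right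
side has one sign and α ≠ 0, so ⟨N, a⟩ vanishes identically. But at a point of greatest height the
tangent plane is orthogonal to a, so N = ±a there, a contradiction.

Forms are handled as families of chart expressions, and the sign of J provides the orientation. The
identity differentiates N, so a continuous Gauss map must first be shown to be smooth
(`IsGaussMap.contMDiff`).

The statement on boundaries covers non-orientable surfaces as well and is therefore proved by the
maximum principle: without boundary, the equation at the highest point gives α ≤ 0 and at the lowest
point α ≥ 0 (`meanCurvature_nonpos_of_max`). -/

noncomputable section

namespace WeightedSurface

open MeasureTheory Set Filter Topology
open scoped Matrix

/-! ### Stokes' theorem and pull-back of two-forms in the plane -/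

/-- A compactly supported factor inside an open set turns a function that is continuous on this set
into an everywhere continuous one. -/
theorem continuous_mul_of_tsupport_subset {X : Type*} [TopologicalSpace X] {A F : X → ℝ}
    {U : Set X} (hU : IsOpen U) (hA : Continuous A) (hAU : tsupport A ⊆ U)
    (hF : ContinuousOn F U) : Continuous fun x => A x * F x := by
  refine continuous_of_tsupport fun x hx => ?_
  have hxU : x ∈ U := hAU (tsupport_mul_subset_left hx)
  exact hA.continuousAt.mul (hF.continuousAt (hU.mem_nhds hxU))

/-- Stokes' theorem for the compactly supported planar `1`-form `A dB`. -/
theorem integral_fderiv_wedge_fderiv_eq_zero {E : Type*} [NormedAddCommGroup E] [NormedSpace ℝ E]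
    [FiniteDimensional ℝ E] [MeasurableSpace E] [BorelSpace E] (μ : Measure E)
    [μ.IsAddHaarMeasure] {A B : E → ℝ} {U : Set E} (hU : IsOpen U) (hA : ContDiff ℝ ∞ A)
    (hAc : HasCompactSupport A) (hAU : tsupport A ⊆ U) (hB : ContDiffOn ℝ ∞ B U) (v w : E) :
    ∫ x, (fderiv ℝ A x v * fderiv ℝ B x w - fderiv ℝ A x w * fderiv ℝ B x v) ∂μ = 0 := by
  have hdB : ContDiffOn ℝ ∞ (fderiv ℝ B) U := hB.fderiv_of_isOpen hU (by simp)
  have hdBv (v : E) : ContDiffOn ℝ ∞ (fun x => fderiv ℝ B x v) U := hdB.clm_apply contDiffOn_const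
  have hdA (v : E) : Continuous fun x => fderiv ℝ A x v :=
    (hA.continuous_fderiv (by simp)).clm_apply continuous_const
  have hdAc (v : E) : HasCompactSupport fun x => fderiv ℝ A x v := hAc.fderiv_apply ℝ v
  have hdAU (v : E) : tsupport (fun x => fderiv ℝ A x v) ⊆ U :=
    (tsupport_fderiv_apply_subset ℝ v).trans hAU
  have hint1 (v w : E) : Integrable (fun x => fderiv ℝ A x v * fderiv ℝ B x w) μ :=
    (continuous_mul_of_tsupport_subset hU (hdA v) (hdAU v)
      (hdBv w).continuousOn).integrable_of_hasCompactSupport (hdAc v).mul_right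
  have hint2 (v w : E) :
      Integrable (fun x => A x * fderiv ℝ (fun y => fderiv ℝ B y w) x v) μ := by
    have h : ContinuousOn (fun x => fderiv ℝ (fun y => fderiv ℝ B y w) x v) U :=
      ((hdBv w).continuousOn_fderiv_of_isOpen hU (by simp)).clm_apply continuousOn_const
    exact (continuous_mul_of_tsupport_subset hU hA.continuous hAU
      h).integrable_of_hasCompactSupport hAc.mul_right
  have hint3 (w : E) : Integrable (fun x => A x * fderiv ℝ B x w) μ :=
    (continuous_mul_of_tsupport_subset hU hA.continuous hAU
      (hdBv w).continuousOn).integrable_of_hasCompactSupport hAc.mul_right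
  -- By parts, each product of first derivatives integrates to minus the integral of A times a mixed
  -- second derivative of B. The mixed derivatives agree on U, and A vanishes off U.
  have key (v w : E) : ∫ x, A x * fderiv ℝ (fun y => fderiv ℝ B y w) x v ∂μ =
      -∫ x, fderiv ℝ A x v * fderiv ℝ B x w ∂μ :=
    integral_mul_fderiv_eq_neg_fderiv_mul_of_integrable (hint1 v w) (hint2 v w) (hint3 w)
      (fun x _ => hA.differentiable (by simp) x)
      (fun x hx => ((hdBv w).differentiableOn (by simp)).differentiableAt
        (hU.mem_nhds (hAU hx)))
  have hsymm : ∫ x, A x * fderiv ℝ (fun y => fderiv ℝ B y w) x v ∂μ =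
      ∫ x, A x * fderiv ℝ (fun y => fderiv ℝ B y v) x w ∂μ := by
    refine integral_congr_ae (Filter.Eventually.of_forall fun x => ?_)
    by_cases hx : x ∈ U
    · have hs : IsSymmSndFDerivAt ℝ B x :=
        (hB.contDiffAt (hU.mem_nhds hx)).isSymmSndFDerivAt
          (by rw [minSmoothness_of_isRCLikeNormedField]; exact WithTop.coe_le_coe.2 le_top)
      have hd : DifferentiableAt ℝ (fderiv ℝ B) x :=
        (hdB.differentiableOn (by simp)).differentiableAt (hU.mem_nhds hx)
      have he (v w : E) : fderiv ℝ (fun y => fderiv ℝ B y w) x v = fderiv ℝ (fderiv ℝ B) x v w := by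
        rw [fderiv_clm_apply hd (differentiableAt_const w)]
        simp
      simp only [he, hs v w]
    · have : A x = 0 := image_eq_zero_of_notMem_tsupport fun h => hx (hAU h)
      simp [this]
  rw [integral_sub (hint1 v w) (hint1 w v)]
  rw [key v w, key w v] at hsymm
  linarith

/-- The pull-back of the `2`-form `ℓ ∧ m` of the plane by a linear map. -/
theorem wedge_comp_eq_mul_det (ℓ m : Plane →L[ℝ] ℝ) (L : Plane →L[ℝ] Plane) :
    ℓ (L (EuclideanSpace.single 0 1)) * m (L (EuclideanSpace.single 1 1)) -
        ℓ (L (EuclideanSpace.single 1 1)) * m (L (EuclideanSpace.single 0 1)) =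
      (ℓ (EuclideanSpace.single 0 1) * m (EuclideanSpace.single 1 1) -
        ℓ (EuclideanSpace.single 1 1) * m (EuclideanSpace.single 0 1)) * L.det := by
  have hdecomp (v : Plane) : v = v 0 • EuclideanSpace.single (0 : Fin 2) (1 : ℝ) +
      v 1 • EuclideanSpace.single (1 : Fin 2) (1 : ℝ) := by
    ext i; fin_cases i <;> simp
  have hdet : L.det = L (EuclideanSpace.single 0 1) 0 * L (EuclideanSpace.single 1 1) 1 -
      L (EuclideanSpace.single 1 1) 0 * L (EuclideanSpace.single 0 1) 1 := by
    rw [ContinuousLinearMap.det, ← LinearMap.det_toMatrix (EuclideanSpace.basisFun (Fin 2) ℝ).toBasis,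
      Matrix.det_fin_two]
    simp [LinearMap.toMatrix_apply]
  rw [hdet]
  rw [hdecomp (L (EuclideanSpace.single 0 1)), hdecomp (L (EuclideanSpace.single 1 1))]
  simp only [map_add, map_smul, smul_eq_mul, PiLp.add_apply, PiLp.smul_apply,
    PiLp.single_apply]
  simp
  ring

/-! ### Two-forms and orientations in charts -/

section Forms

variable {M : Type*} [TopologicalSpace M] [ChartedSpace Plane M]

/-- The expression `du ∧ dw (e₁, e₂)` of a `2`-form on a surface without boundary in the preferred
chart at `q`. -/
def wedge (u w : M → ℝ) (q : M) (x : Plane) : ℝ :=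
  fderiv ℝ (u ∘ (extChartAt (𝓡 2) q).symm) x (EuclideanSpace.single 0 1) *
      fderiv ℝ (w ∘ (extChartAt (𝓡 2) q).symm) x (EuclideanSpace.single 1 1) -
    fderiv ℝ (u ∘ (extChartAt (𝓡 2) q).symm) x (EuclideanSpace.single 1 1) *
      fderiv ℝ (w ∘ (extChartAt (𝓡 2) q).symm) x (EuclideanSpace.single 0 1)

/-- The Jacobian determinant of the change from the preferred chart at `q` to the one at `r`. -/
def transitionDet (q r : M) (x : Plane) : ℝ :=
  (fderiv ℝ (extChartAt (𝓡 2) r ∘ (extChartAt (𝓡 2) q).symm) x).det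

/-- The set where the change from the preferred chart at `q` to the one at `r` is defined. -/
def overlap (q r : M) : Set Plane :=
  (extChartAt (𝓡 2) q).target ∩ (extChartAt (𝓡 2) q).symm ⁻¹' (extChartAt (𝓡 2) r).source

/-- The family of functions `β q` consists of the expressions of one `2`-form in the charts. -/
def IsTwoForm (β : M → Plane → ℝ) : Prop :=
  ∀ q r : M, ∀ x ∈ overlap q r,
    β q x = β r (extChartAt (𝓡 2) r ((extChartAt (𝓡 2) q).symm x)) * transitionDet q r x

/-- The locally constant functions `o q` are the signs of the charts for some orientation. -/
structure IsOrientation (o : M → Plane → ℝ) : Prop where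
  eventually_eq : ∀ q : M, ∀ x ∈ (extChartAt (𝓡 2) q).target, ∀ᶠ y in 𝓝 x, o q y = o q x
  coord_change : ∀ q r : M, ∀ x ∈ overlap q r,
    o q x * transitionDet q r x =
      o r (extChartAt (𝓡 2) r ((extChartAt (𝓡 2) q).symm x)) * |transitionDet q r x|

theorem isOpen_overlap (q r : M) : IsOpen (overlap q r) :=
  (continuousOn_extChartAt_symm q).isOpen_inter_preimage (isOpen_extChartAt_target q)
    (isOpen_extChartAt_source r)

theorem mem_overlap_swap {q r : M} {x : Plane} (hx : x ∈ overlap q r) :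
    extChartAt (𝓡 2) r ((extChartAt (𝓡 2) q).symm x) ∈ overlap r q := by
  refine ⟨(extChartAt (𝓡 2) r).map_source hx.2, ?_⟩
  rw [mem_preimage, (extChartAt (𝓡 2) r).left_inv hx.2]
  exact (extChartAt (𝓡 2) q).map_target hx.1

theorem transition_transition {q r : M} {x : Plane} (hx : x ∈ overlap q r) :
    extChartAt (𝓡 2) q ((extChartAt (𝓡 2) r).symm
      (extChartAt (𝓡 2) r ((extChartAt (𝓡 2) q).symm x))) = x := by
  rw [(extChartAt (𝓡 2) r).left_inv hx.2, (extChartAt (𝓡 2) q).right_inv hx.1]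

theorem image_transition_overlap (q r : M) :
    (extChartAt (𝓡 2) r ∘ (extChartAt (𝓡 2) q).symm) '' overlap q r = overlap r q := by
  ext y
  constructor
  · rintro ⟨x, hx, rfl⟩
    exact mem_overlap_swap hx
  · exact fun hy => ⟨_, mem_overlap_swap hy, transition_transition hy⟩

theorem differentiableAt_transition [IsManifold (𝓡 2) ∞ M] {q r : M} {x : Plane}
    (hx : x ∈ overlap q r) :
    DifferentiableAt ℝ (extChartAt (𝓡 2) r ∘ (extChartAt (𝓡 2) q).symm) x := by
  have h := contDiffOn_ext_coord_change (I := 𝓡 2) (n := ∞) r q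
  refine (h.differentiableOn (by simp)).differentiableAt ?_
  have hs : ((extChartAt (𝓡 2) q).symm ≫ extChartAt (𝓡 2) r).source = overlap q r := by
    ext y; simp [overlap]
  rw [hs]
  exact (isOpen_overlap q r).mem_nhds hx

theorem contDiffOn_comp_extChartAt_symm [IsManifold (𝓡 2) ∞ M] {F : Type*}
    [NormedAddCommGroup F] [NormedSpace ℝ F] {u : M → F} (hu : ContMDiff (𝓡 2) 𝓘(ℝ, F) ∞ u)
    (q : M) : ContDiffOn ℝ ∞ (u ∘ (extChartAt (𝓡 2) q).symm) (extChartAt (𝓡 2) q).target :=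
  contMDiffOn_iff_contDiffOn.1 (hu.comp_contMDiffOn (contMDiffOn_extChartAt_symm q))

theorem differentiableAt_comp_extChartAt_symm [IsManifold (𝓡 2) ∞ M] {F : Type*}
    [NormedAddCommGroup F] [NormedSpace ℝ F] {u : M → F} (hu : ContMDiff (𝓡 2) 𝓘(ℝ, F) ∞ u)
    {q : M} {x : Plane} (hx : x ∈ (extChartAt (𝓡 2) q).target) :
    DifferentiableAt ℝ (u ∘ (extChartAt (𝓡 2) q).symm) x :=
  ((contDiffOn_comp_extChartAt_symm hu q).differentiableOn (by simp)).differentiableAt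
    ((isOpen_extChartAt_target q).mem_nhds hx)

/-- The chain rule for a change of charts. -/
theorem fderiv_comp_extChartAt_symm [IsManifold (𝓡 2) ∞ M] {F : Type*}
    [NormedAddCommGroup F] [NormedSpace ℝ F] {u : M → F} (hu : ContMDiff (𝓡 2) 𝓘(ℝ, F) ∞ u)
    {q r : M} {x : Plane} (hx : x ∈ overlap q r) :
    fderiv ℝ (u ∘ (extChartAt (𝓡 2) q).symm) x =
      (fderiv ℝ (u ∘ (extChartAt (𝓡 2) r).symm)
        (extChartAt (𝓡 2) r ((extChartAt (𝓡 2) q).symm x))).comp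
      (fderiv ℝ (extChartAt (𝓡 2) r ∘ (extChartAt (𝓡 2) q).symm) x) := by
  have h : u ∘ (extChartAt (𝓡 2) q).symm =ᶠ[𝓝 x] (u ∘ (extChartAt (𝓡 2) r).symm) ∘
      (extChartAt (𝓡 2) r ∘ (extChartAt (𝓡 2) q).symm) := by
    filter_upwards [(isOpen_overlap q r).mem_nhds hx] with y hy
    simp only [Function.comp_apply]
    rw [(extChartAt (𝓡 2) r).left_inv hy.2]
  rw [h.fderiv_eq]
  exact fderiv_comp x (differentiableAt_comp_extChartAt_symm hu (mem_overlap_swap hx).1)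
    (differentiableAt_transition hx)

theorem isTwoForm_wedge [IsManifold (𝓡 2) ∞ M] {u w : M → ℝ}
    (hu : ContMDiff (𝓡 2) 𝓘(ℝ, ℝ) ∞ u) (hw : ContMDiff (𝓡 2) 𝓘(ℝ, ℝ) ∞ w) :
    IsTwoForm (wedge u w) := by
  intro q r x hx
  unfold wedge transitionDet
  rw [fderiv_comp_extChartAt_symm hu hx, fderiv_comp_extChartAt_symm hw hx]
  exact wedge_comp_eq_mul_det _ _ _

theorem IsTwoForm.const_mul {β : M → Plane → ℝ} (hβ : IsTwoForm β) (g : M → ℝ) :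
    IsTwoForm fun q x => g ((extChartAt (𝓡 2) q).symm x) * β q x := by
  intro q r x hx
  simp only
  rw [(extChartAt (𝓡 2) r).left_inv hx.2, hβ q r x hx, mul_assoc]

theorem IsTwoForm.add {β γ : M → Plane → ℝ} (hβ : IsTwoForm β) (hγ : IsTwoForm γ) :
    IsTwoForm fun q x => β q x + γ q x := by
  intro q r x hx
  simp only
  rw [hβ q r x hx, hγ q r x hx, add_mul]

/-- Curvatures are defined at a point only through the chart preferred there. This overlap is what
carries pointwise identities from those charts to a whole chart. -/
theorem mem_overlap_self {q : M} {x : Plane} (hx : x ∈ (extChartAt (𝓡 2) q).target) :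
    x ∈ overlap q ((extChartAt (𝓡 2) q).symm x) :=
  ⟨hx, mem_extChartAt_source _⟩

/-- Two `2`-forms agree if they agree at every point in the preferred chart at this point. -/
theorem IsTwoForm.eqOn {β γ : M → Plane → ℝ} (hβ : IsTwoForm β) (hγ : IsTwoForm γ)
    (h : ∀ p : M, β p (extChartAt (𝓡 2) p p) = γ p (extChartAt (𝓡 2) p p)) (q : M) :
    EqOn (β q) (γ q) (extChartAt (𝓡 2) q).target := by
  intro x hx
  rw [hβ q _ x (mem_overlap_self hx), hγ q _ x (mem_overlap_self hx), h]

/-- A `2`-form does not vanish if it does not vanish at any point in the preferred chart at this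
point. -/
theorem IsTwoForm.ne_zero {β : M → Plane → ℝ} (hβ : IsTwoForm β)
    (h : ∀ p : M, β p (extChartAt (𝓡 2) p p) ≠ 0) {q : M} {x : Plane}
    (hx : x ∈ (extChartAt (𝓡 2) q).target) : β q x ≠ 0 := by
  -- The change of charts is read from the preferred chart at the point back to the chart at q, so
  -- that `β q x` appears as a factor.
  have hx' := mem_overlap_swap (mem_overlap_self hx)
  have := hβ _ _ _ hx'
  rw [transition_transition (mem_overlap_self hx)] at this
  intro h0
  rw [h0, zero_mul] at this
  exact h _ this

/-- A `2`-form supported in the intersection of two chart domains has the same integral in both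
charts. -/
theorem setIntegral_target_eq_of_support_subset [IsManifold (𝓡 2) ∞ M] {o β : M → Plane → ℝ}
    (ho : IsOrientation o) (hβ : IsTwoForm β) (i j : M)
    (h : ∀ q : M, ∀ x ∈ (extChartAt (𝓡 2) q).target, (extChartAt (𝓡 2) q).symm x ∉
      (extChartAt (𝓡 2) i).source ∩ (extChartAt (𝓡 2) j).source → β q x = 0) :
    ∫ x in (extChartAt (𝓡 2) i).target, o i x * β i x =
      ∫ x in (extChartAt (𝓡 2) j).target, o j x * β j x := by
  have hred (q r : M) (h : ∀ x ∈ (extChartAt (𝓡 2) q).target,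
      (extChartAt (𝓡 2) q).symm x ∉ (extChartAt (𝓡 2) r).source → β q x = 0) :
      ∫ x in (extChartAt (𝓡 2) q).target, o q x * β q x =
        ∫ x in overlap q r, o q x * β q x := by
    refine setIntegral_eq_of_subset_of_forall_sdiff_eq_zero
      (isOpen_extChartAt_target q).measurableSet inter_subset_left fun x hx => ?_
    rw [h x hx.1 fun hs => hx.2 ⟨hx.1, hs⟩, mul_zero]
  rw [hred i j fun x hx hs => h i x hx fun hs' => hs hs'.2,
    hred j i fun x hx hs => h j x hx fun hs' => hs hs'.1, ← image_transition_overlap i j,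
    integral_image_eq_integral_abs_det_fderiv_smul volume (isOpen_overlap i j).measurableSet
      (fun x hx => (differentiableAt_transition hx).hasFDerivAt.hasFDerivWithinAt)
      (fun x hx y hy hxy => by
        rw [← transition_transition hx, ← transition_transition hy]
        simp only [Function.comp_apply] at hxy
        rw [hxy])]
  refine setIntegral_congr_fun (isOpen_overlap i j).measurableSet fun x hx => ?_
  simp only [Function.comp_apply, smul_eq_mul]
  -- The form transforms by the Jacobian determinant and the integral by its absolute value; the
  -- sign `o` trades one for the other.
  have h1 := ho.coord_change i j x hx
  rw [hβ i j x hx]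
  change _ = |transitionDet i j x| * _
  linear_combination β j (extChartAt (𝓡 2) j ((extChartAt (𝓡 2) i).symm x)) * h1

end Forms

/-! ### Stokes' theorem on a closed oriented surface -/

section Stokes

variable {M : Type*} [TopologicalSpace M] [ChartedSpace Plane M]

theorem wedge_eq_zero_of_notMem_tsupport {u w : M → ℝ} {q : M} {x : Plane}
    (hx : x ∈ (extChartAt (𝓡 2) q).target) (hu : (extChartAt (𝓡 2) q).symm x ∉ tsupport u) :
    wedge u w q x = 0 := by
  have h : u ∘ (extChartAt (𝓡 2) q).symm =ᶠ[𝓝 x] fun _ => 0 := by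
    have hc : ContinuousAt (extChartAt (𝓡 2) q).symm x :=
      (continuousOn_extChartAt_symm q).continuousAt ((isOpen_extChartAt_target q).mem_nhds hx)
    filter_upwards [hc.preimage_mem_nhds ((isClosed_tsupport u).isOpen_compl.mem_nhds hu)] with y hy
    rw [Function.comp_apply, image_eq_zero_of_notMem_tsupport hy]
  unfold wedge
  rw [h.fderiv_eq]
  simp

theorem contDiffOn_wedge [IsManifold (𝓡 2) ∞ M] {u w : M → ℝ}
    (hu : ContMDiff (𝓡 2) 𝓘(ℝ, ℝ) ∞ u) (hw : ContMDiff (𝓡 2) 𝓘(ℝ, ℝ) ∞ w) (q : M) :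
    ContDiffOn ℝ ∞ (wedge u w q) (extChartAt (𝓡 2) q).target := by
  have h {u : M → ℝ} (hu : ContMDiff (𝓡 2) 𝓘(ℝ, ℝ) ∞ u) (v : Plane) :
      ContDiffOn ℝ ∞ (fun x => fderiv ℝ (u ∘ (extChartAt (𝓡 2) q).symm) x v)
        (extChartAt (𝓡 2) q).target :=
    ((contDiffOn_comp_extChartAt_symm hu q).fderiv_of_isOpen
      (isOpen_extChartAt_target q) (by simp)).clm_apply contDiffOn_const
  exact ((h hu _).mul (h hw _)).sub ((h hu _).mul (h hw _))

theorem IsOrientation.continuousOn {o : M → Plane → ℝ} (ho : IsOrientation o) (q : M) :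
    ContinuousOn (o q) (extChartAt (𝓡 2) q).target := fun x hx =>
  (continuousAt_const.congr ((ho.eventually_eq q x hx).mono fun _ h => h.symm)).continuousWithinAt

theorem isCompact_extChartAt_image [CompactSpace M] {q : M} {K : Set M} (hK : IsClosed K)
    (hKq : K ⊆ (extChartAt (𝓡 2) q).source) : IsCompact (extChartAt (𝓡 2) q '' K) :=
  hK.isCompact.image_of_continuousOn ((continuousOn_extChartAt q).mono hKq)

theorem image_extChartAt_subset_target {q : M} {K : Set M}
    (hKq : K ⊆ (extChartAt (𝓡 2) q).source) :
    extChartAt (𝓡 2) q '' K ⊆ (extChartAt (𝓡 2) q).target := by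
  rintro _ ⟨p, hp, rfl⟩
  exact (extChartAt (𝓡 2) q).map_source (hKq hp)

theorem mem_image_extChartAt {q : M} {K : Set M} {x : Plane}
    (hx : x ∈ (extChartAt (𝓡 2) q).target) (hK : (extChartAt (𝓡 2) q).symm x ∈ K) :
    x ∈ extChartAt (𝓡 2) q '' K :=
  ⟨_, hK, (extChartAt (𝓡 2) q).right_inv hx⟩

/-- Continuity on an open chart target gives no integrability by itself; here F vanishes off the
image of K, which is compact. -/
theorem integrableOn_target [CompactSpace M] {q : M} {K : Set M} (hK : IsClosed K)
    (hKq : K ⊆ (extChartAt (𝓡 2) q).source) {F : Plane → ℝ}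
    (hF : ContinuousOn F (extChartAt (𝓡 2) q).target)
    (h0 : ∀ x ∈ (extChartAt (𝓡 2) q).target, (extChartAt (𝓡 2) q).symm x ∉ K → F x = 0) :
    IntegrableOn F (extChartAt (𝓡 2) q).target := by
  have hc := isCompact_extChartAt_image hK hKq
  refine IntegrableOn.of_forall_sdiff_eq_zero
    ((hF.mono (image_extChartAt_subset_target hKq)).integrableOn_compact hc)
    (isOpen_extChartAt_target q).measurableSet fun x hx => h0 x hx.1 fun hs =>
      hx.2 (mem_image_extChartAt hx.1 hs)

/-- Stokes' theorem in one chart. -/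
theorem setIntegral_wedge_eq_zero [CompactSpace M] [IsManifold (𝓡 2) ∞ M] {o : M → Plane → ℝ}
    (ho : IsOrientation o) {u w : M → ℝ} (hu : ContMDiff (𝓡 2) 𝓘(ℝ, ℝ) ∞ u)
    (hw : ContMDiff (𝓡 2) 𝓘(ℝ, ℝ) ∞ w) {q : M} (huq : tsupport u ⊆ (extChartAt (𝓡 2) q).source) :
    ∫ x in (extChartAt (𝓡 2) q).target, o q x * wedge u w q x = 0 := by
  classical
  set V := (extChartAt (𝓡 2) q).target with hV
  have hVo : IsOpen V := isOpen_extChartAt_target q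
  set K := extChartAt (𝓡 2) q '' tsupport u with hKdef
  have hK : IsCompact K := isCompact_extChartAt_image (isClosed_tsupport u) huq
  have hKV : K ⊆ V := image_extChartAt_subset_target huq
  -- The sign is absorbed into A: being locally constant, it passes through derivatives. Extension
  -- by zero stays smooth because the support of u has compact image in V.
  set A : Plane → ℝ := V.indicator fun x => o q x * u ((extChartAt (𝓡 2) q).symm x) with hA
  have hA0 {x : Plane} (hx : x ∉ K) : A x = 0 := by
    rw [hA, indicator_apply_eq_zero]
    intro hxV
    rw [image_eq_zero_of_notMem_tsupport fun hs => hx (mem_image_extChartAt hxV hs), mul_zero]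
  have hAK : tsupport A ⊆ K :=
    closure_minimal (fun x hx => by_contra fun h => hx (hA0 h)) hK.isClosed
  have hloc {x : Plane} (hx : x ∈ V) :
      A =ᶠ[𝓝 x] fun y => o q x * (u ∘ (extChartAt (𝓡 2) q).symm) y := by
    filter_upwards [hVo.mem_nhds hx, ho.eventually_eq q x hx] with y hy hoy
    rw [hA, indicator_of_mem hy, hoy, Function.comp_apply]
  have hAs : ContDiff ℝ ∞ A := by
    rw [contDiff_iff_contDiffAt]
    intro x
    by_cases hx : x ∈ V
    · exact (contDiffAt_const.mul ((contDiffOn_comp_extChartAt_symm hu q).contDiffAt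
        (hVo.mem_nhds hx))).congr_of_eventuallyEq (hloc hx)
    · have : A =ᶠ[𝓝 x] fun _ => 0 := by
        filter_upwards [hK.isClosed.isOpen_compl.mem_nhds fun h => hx (hKV h)] with y hy
        exact hA0 hy
      exact contDiffAt_const.congr_of_eventuallyEq this
  have hstokes := integral_fderiv_wedge_fderiv_eq_zero volume hVo hAs
    (hK.of_isClosed_subset (isClosed_tsupport A) hAK) (hAK.trans hKV)
    (contDiffOn_comp_extChartAt_symm hw q) (EuclideanSpace.single 0 1) (EuclideanSpace.single 1 1)
  rw [← setIntegral_eq_integral_of_forall_compl_eq_zero (s := V)] at hstokes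
  · rw [← hstokes]
    refine setIntegral_congr_fun hVo.measurableSet fun x hx => ?_
    rw [(hloc hx).fderiv_eq, fderiv_const_mul (differentiableAt_comp_extChartAt_symm hu hx)]
    simp only [wedge, _root_.smul_apply, smul_eq_mul]
    ring
  · intro x hx
    have : fderiv ℝ A x = 0 := by
      refine image_eq_zero_of_notMem_tsupport fun h => hx (hKV (hAK ?_))
      exact tsupport_fderiv_subset ℝ h
    simp [this]

/-- A finite smooth partition of unity subordinate to the domains of the preferred charts. -/
structure IsChartPartition (t : Finset M) (ρ : M → M → ℝ) : Prop where
  contMDiff : ∀ q, ContMDiff (𝓡 2) 𝓘(ℝ, ℝ) ∞ (ρ q)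
  nonneg : ∀ q p, 0 ≤ ρ q p
  tsupport_subset : ∀ q, tsupport (ρ q) ⊆ (extChartAt (𝓡 2) q).source
  sum_eq_one : ∀ p, ∑ q ∈ t, ρ q p = 1

theorem exists_isChartPartition (M : Type*) [TopologicalSpace M] [ChartedSpace Plane M]
    [T2Space M] [CompactSpace M] [IsManifold (𝓡 2) ∞ M] :
    ∃ (t : Finset M) (ρ : M → M → ℝ), IsChartPartition t ρ := by
  obtain ⟨f, hf⟩ := SmoothPartitionOfUnity.exists_isSubordinate_chartAt_source (𝓡 2) M
  have hfin : {q | (Function.support (f q)).Nonempty}.Finite :=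
    f.locallyFinite.finite_nonempty_of_compact
  refine ⟨hfin.toFinset, fun q => f q, fun q => (f q).contMDiff, fun q p => f.nonneg q p,
    fun q => ?_, fun p => ?_⟩
  · rw [extChartAt_source]
    exact hf q
  · rw [← f.sum_eq_one (mem_univ p)]
    refine (finsum_eq_sum_of_support_subset _ fun q hq => ?_).symm
    simp only [Finite.coe_toFinset, mem_ofPred_eq]
    exact ⟨p, hq⟩

theorem wedge_eq_sum [IsManifold (𝓡 2) ∞ M] {t : Finset M} {ρ : M → M → ℝ}
    (hρ : IsChartPartition t ρ) {u : M → ℝ} (hu : ContMDiff (𝓡 2) 𝓘(ℝ, ℝ) ∞ u) (w : M → ℝ)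
    {q : M} {x : Plane} (hx : x ∈ (extChartAt (𝓡 2) q).target) :
    wedge u w q x = ∑ i ∈ t, wedge (fun p => ρ i p * u p) w q x := by
  have h : u ∘ (extChartAt (𝓡 2) q).symm =
      fun y => ∑ i ∈ t, ((fun p => ρ i p * u p) ∘ (extChartAt (𝓡 2) q).symm) y := by
    ext y
    simp only [Function.comp_apply]
    rw [← Finset.sum_mul, hρ.sum_eq_one, one_mul]
  have hd (v : Plane) : fderiv ℝ (u ∘ (extChartAt (𝓡 2) q).symm) x v =
      ∑ i ∈ t, fderiv ℝ ((fun p => ρ i p * u p) ∘ (extChartAt (𝓡 2) q).symm) x v := by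
    rw [h, fderiv_fun_sum fun i _ => differentiableAt_comp_extChartAt_symm
      (u := fun p => ρ i p * u p) ((hρ.contMDiff i).mul hu) hx, _root_.sum_apply]
  simp only [wedge]
  rw [hd, hd, Finset.sum_sub_distrib, Finset.sum_mul, Finset.sum_mul]

/-- Stokes' theorem for the `1`-form `u dw` on a closed oriented surface. -/
theorem sum_setIntegral_wedge_eq_zero [CompactSpace M] [IsManifold (𝓡 2) ∞ M]
    {o : M → Plane → ℝ} (ho : IsOrientation o) {t : Finset M} {ρ : M → M → ℝ}
    (hρ : IsChartPartition t ρ) {u w : M → ℝ} (hu : ContMDiff (𝓡 2) 𝓘(ℝ, ℝ) ∞ u)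
    (hw : ContMDiff (𝓡 2) 𝓘(ℝ, ℝ) ∞ w) :
    ∑ j ∈ t, ∫ x in (extChartAt (𝓡 2) j).target,
      o j x * (ρ j ((extChartAt (𝓡 2) j).symm x) * wedge u w j x) = 0 := by
  have hv (i : M) : ContMDiff (𝓡 2) 𝓘(ℝ, ℝ) ∞ fun p => ρ i p * u p := (hρ.contMDiff i).mul hu
  have hvs (i : M) : tsupport (fun p => ρ i p * u p) ⊆ tsupport (ρ i) := tsupport_mul_subset_left
  have hcont (i j q : M) : ContinuousOn
      (fun x => o q x * (ρ j ((extChartAt (𝓡 2) q).symm x) * wedge (fun p => ρ i p * u p) w q x))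
      (extChartAt (𝓡 2) q).target :=
    (ho.continuousOn q).mul (((hρ.contMDiff j).continuous.comp_continuousOn
      (continuousOn_extChartAt_symm q)).mul (contDiffOn_wedge (hv i) hw q).continuousOn)
  -- The partition of unity is inserted a second time, into u. The (i, j) term lives in both chart
  -- domains, so `h2` moves it from chart j to chart i; there the sum over j of the ρ j is 1 and
  -- Stokes in one chart applies.
  have h1 (j : M) : ∫ x in (extChartAt (𝓡 2) j).target,
      o j x * (ρ j ((extChartAt (𝓡 2) j).symm x) * wedge u w j x) =
      ∑ i ∈ t, ∫ x in (extChartAt (𝓡 2) j).target,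
        o j x * (ρ j ((extChartAt (𝓡 2) j).symm x) * wedge (fun p => ρ i p * u p) w j x) := by
    rw [← integral_finsetSum]
    · refine setIntegral_congr_fun (isOpen_extChartAt_target j).measurableSet fun x hx => ?_
      rw [wedge_eq_sum hρ hu w hx, Finset.mul_sum, Finset.mul_sum]
    · intro i _
      refine integrableOn_target (isClosed_tsupport _) (hρ.tsupport_subset j) (hcont i j j) ?_
      intro x _ hxs
      rw [image_eq_zero_of_notMem_tsupport hxs, zero_mul, mul_zero]
  have h2 (i j : M) : ∫ x in (extChartAt (𝓡 2) j).target,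
        o j x * (ρ j ((extChartAt (𝓡 2) j).symm x) * wedge (fun p => ρ i p * u p) w j x) =
      ∫ x in (extChartAt (𝓡 2) i).target,
        o i x * (ρ j ((extChartAt (𝓡 2) i).symm x) * wedge (fun p => ρ i p * u p) w i x) := by
    refine setIntegral_target_eq_of_support_subset ho
      ((isTwoForm_wedge (hv i) hw).const_mul (ρ j)) j i fun q x hx hxs => ?_
    by_cases hj : (extChartAt (𝓡 2) q).symm x ∈ tsupport (ρ j)
    · rw [wedge_eq_zero_of_notMem_tsupport hx, mul_zero]
      exact fun hi => hxs ⟨hρ.tsupport_subset j hj, hρ.tsupport_subset i (hvs i hi)⟩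
    · rw [image_eq_zero_of_notMem_tsupport hj, zero_mul]
  simp only [h1]
  rw [Finset.sum_comm]
  refine Finset.sum_eq_zero fun i _ => ?_
  simp only [h2]
  rw [← integral_finsetSum]
  · rw [← setIntegral_wedge_eq_zero ho (hv i) hw ((hvs i).trans (hρ.tsupport_subset i))]
    refine integral_congr_ae (Eventually.of_forall fun x => ?_)
    simp only
    rw [← Finset.mul_sum, ← Finset.sum_mul, hρ.sum_eq_one, one_mul]
  · intro j _
    refine integrableOn_target (isClosed_tsupport _) (hρ.tsupport_subset i) (hcont i j i) ?_
    intro x hx hxs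
    rw [wedge_eq_zero_of_notMem_tsupport hx fun h => hxs (hvs i h), mul_zero, mul_zero]

end Stokes

/-! ### Cross products of tangent vectors -/

section Algebra

/-- Since n × (x × y) = (n · y) x - (n · x) y = 0, the product is parallel to the unit vector n. Up
to sign, the coefficients below are components of x × y, n × x and n × y. -/
theorem cross_eq_smul {n x y : Fin 3 → ℝ} (hn : n ⬝ᵥ n = 1) (hx : x ⬝ᵥ n = 0)
    (hy : y ⬝ᵥ n = 0) : x ⨯₃ y = (n ⬝ᵥ (x ⨯₃ y)) • n := by
  simp only [cross_apply, dotProduct, Fin.sum_univ_three] at *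
  ext k
  fin_cases k
  · simp
    linear_combination (-(x 1 * y 2 - x 2 * y 1)) * hn + (n 2 * x 1 - n 1 * x 2) * hy +
      (n 1 * y 2 - n 2 * y 1) * hx
  · simp
    linear_combination (-(x 2 * y 0 - x 0 * y 2)) * hn + (n 0 * x 2 - n 2 * x 0) * hy +
      (n 2 * y 0 - n 0 * y 2) * hx
  · simp
    linear_combination (-(x 0 * y 1 - x 1 * y 0)) * hn + (n 1 * x 0 - n 0 * x 1) * hy +
      (n 0 * y 1 - n 1 * y 0) * hx

/-- `p` and `q` stand for the derivatives of the unit normal `n` in the directions `x` and `y`. -/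
theorem mul_sub_eq_of_tangent {n x y p q : Fin 3 → ℝ} (a : Fin 3 → ℝ) (hn : n ⬝ᵥ n = 1)
    (hx : x ⬝ᵥ n = 0) (hy : y ⬝ᵥ n = 0) (hp : p ⬝ᵥ n = 0) (hq : q ⬝ᵥ n = 0) :
    (n ⬝ᵥ (x ⨯₃ y)) * (a ⬝ᵥ (p ⨯₃ y) - a ⬝ᵥ (q ⨯₃ x)) =
      (a ⬝ᵥ n) * ((p ⬝ᵥ x) * (y ⬝ᵥ y) - (p ⬝ᵥ y) * (x ⬝ᵥ y) - (q ⬝ᵥ x) * (x ⬝ᵥ y) +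
        (q ⬝ᵥ y) * (x ⬝ᵥ x)) := by
  -- All these cross products are multiples of n, so a product of their n-components is their dot
  -- product, given by the Binet–Cauchy identity. With p, q the derivatives of the normal, the
  -- bracket on the right is -2H det g.
  have h1 := cross_eq_smul hn hp hy
  have h2 := cross_eq_smul hn hq hx
  have h3 := cross_eq_smul hn hx hy
  have h4 := cross_dot_cross p y x y
  have h5 := cross_dot_cross q x x y
  rw [h1, h3, smul_dotProduct, dotProduct_smul, hn, smul_eq_mul, smul_eq_mul] at h4
  rw [h2, h3, smul_dotProduct, dotProduct_smul, hn, smul_eq_mul, smul_eq_mul] at h5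
  rw [h1, h2, dotProduct_smul, dotProduct_smul, smul_eq_mul, smul_eq_mul]
  rw [dotProduct_comm y x] at h4
  linear_combination (a ⬝ᵥ n) * h4 - (a ⬝ᵥ n) * h5

/-- Lagrange's identity, as x × y is its own n-component. It identifies J² with det g. -/
theorem sq_dotProduct_cross {n x y : Fin 3 → ℝ} (hn : n ⬝ᵥ n = 1) (hx : x ⬝ᵥ n = 0)
    (hy : y ⬝ᵥ n = 0) :
    (n ⬝ᵥ (x ⨯₃ y)) ^ 2 = (x ⬝ᵥ x) * (y ⬝ᵥ y) - (x ⬝ᵥ y) * (x ⬝ᵥ y) := by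
  have h3 := cross_eq_smul hn hx hy
  have h4 := cross_dot_cross x y x y
  rw [h3, smul_dotProduct, dotProduct_smul, hn, smul_eq_mul, smul_eq_mul,
    dotProduct_comm y x] at h4
  linear_combination h4

/-- Adjugate formula for the inverse. If det g = 0, both sides are 0 by the conventions for inverse
and division. -/
theorem trace_nonsing_inv_mul (g b : Matrix (Fin 2) (Fin 2) ℝ) :
    (g⁻¹ * b).trace =
      (g 1 1 * b 0 0 - g 0 1 * b 1 0 - g 1 0 * b 0 1 + g 0 0 * b 1 1) / g.det := by
  rw [Matrix.inv_def, Matrix.adjugate_fin_two, Ring.inverse_eq_inv', Matrix.smul_mul,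
    Matrix.trace_smul, Matrix.trace_fin_two, smul_eq_mul, div_eq_inv_mul]
  simp [Matrix.mul_apply]
  left
  ring

theorem inner_eq_dotProduct (v w : Space) : inner ℝ v w = v.ofLp ⬝ᵥ w.ofLp := by
  rw [EuclideanSpace.inner_eq_star_dotProduct, dotProduct_comm]
  simp

end Algebra

/-! ### The differential in coordinates -/

section Differential

variable {H : Type*} [TopologicalSpace H] {I : ModelWithCorners ℝ Plane H}
  {M : Type*} [TopologicalSpace M] [ChartedSpace H M]

theorem differential_eq_fderivWithin {f : M → Space} (hf : ContMDiff I 𝓘(ℝ, Space) ∞ f) (p : M) :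
    differential I f p =
      fderivWithin ℝ (localParam I f p) (range I) (extChartAt I p p) := by
  have h : MDifferentiableAt I 𝓘(ℝ, Space) f p := hf.mdifferentiable (by simp) p
  rw [differential, h.mfderiv, writtenInExtChartAt, extChartAt_model_space_eq_id]
  rfl

/-- The coordinate vectors of an immersion are linearly independent. -/
theorem cross_partialDeriv_ne_zero {f : M → Space} (hf : ContMDiff I 𝓘(ℝ, Space) ∞ f) {p : M}
    (hinj : Function.Injective (differential I f p)) :
    (partialDeriv I f p 0 (extChartAt I p p)).ofLp ⨯₃
      (partialDeriv I f p 1 (extChartAt I p p)).ofLp ≠ 0 := by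
  intro h
  have hX (i : Fin 2) : differential I f p (EuclideanSpace.single i 1) =
      partialDeriv I f p i (extChartAt I p p) := by
    rw [differential_eq_fderivWithin hf, partialDeriv]
  have hX0 := hX 0
  have hX1 := hX 1
  generalize partialDeriv I f p 0 (extChartAt I p p) = X at h hX0
  generalize partialDeriv I f p 1 (extChartAt I p p) = Y at h hX1
  -- The image of this vector is (X · Y) X - (X · X) Y = X × (X × Y) = 0. Injectivity then forces X
  -- · X = 0.
  have h0 : differential I f p ((X.ofLp ⬝ᵥ Y.ofLp) • EuclideanSpace.single 0 1 -
      (X.ofLp ⬝ᵥ X.ofLp) • EuclideanSpace.single 1 1) = 0 := by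
    rw [map_sub, map_smul, map_smul, hX0, hX1]
    ext k
    have h0 := congrFun h 0
    have h1 := congrFun h 1
    have h2 := congrFun h 2
    simp [cross_apply] at h0 h1 h2
    fin_cases k
    · simp [dotProduct, Fin.sum_univ_three]
      linear_combination X 1 * h2 - X 2 * h1
    · simp [dotProduct, Fin.sum_univ_three]
      linear_combination X 2 * h0 - X 0 * h2
    · simp [dotProduct, Fin.sum_univ_three]
      linear_combination X 0 * h1 - X 1 * h0
  have h1 := congrArg (fun v : Plane => v 1) (hinj (h0.trans (map_zero _).symm))
  simp at h1
  have h2 : differential I f p (EuclideanSpace.single 0 1) = 0 := by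
    rw [hX0, h1]
  have h3 := congrArg (fun v : Plane => v 0) (hinj (h2.trans (map_zero _).symm))
  simp at h3

end Differential

/-! ### The area form and smoothness of the Gauss map -/

section AreaForm

variable {M : Type*} [TopologicalSpace M] [ChartedSpace Plane M]

theorem partialDeriv_eq_fderiv (f : M → Space) (q : M) (i : Fin 2) (x : Plane) :
    partialDeriv (𝓡 2) f q i x =
      fderiv ℝ (f ∘ (extChartAt (𝓡 2) q).symm) x (EuclideanSpace.single i 1) := by
  rw [partialDeriv, (𝓡 2).range_eq_univ, fderivWithin_univ]
  rfl

theorem wedge_clm_comp [IsManifold (𝓡 2) ∞ M] {u w : M → Space}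
    (hu : ContMDiff (𝓡 2) 𝓘(ℝ, Space) ∞ u) (hw : ContMDiff (𝓡 2) 𝓘(ℝ, Space) ∞ w)
    (ℓ m : Space →L[ℝ] ℝ) {q : M} {x : Plane} (hx : x ∈ (extChartAt (𝓡 2) q).target) :
    wedge (fun p => ℓ (u p)) (fun p => m (w p)) q x =
      ℓ (partialDeriv (𝓡 2) u q 0 x) * m (partialDeriv (𝓡 2) w q 1 x) -
        ℓ (partialDeriv (𝓡 2) u q 1 x) * m (partialDeriv (𝓡 2) w q 0 x) := by
  have h {u : M → Space} (hu : ContMDiff (𝓡 2) 𝓘(ℝ, Space) ∞ u) (ℓ : Space →L[ℝ] ℝ) (i : Fin 2) :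
      fderiv ℝ ((fun p => ℓ (u p)) ∘ (extChartAt (𝓡 2) q).symm) x (EuclideanSpace.single i 1) =
        ℓ (partialDeriv (𝓡 2) u q i x) := by
    have := ((ℓ.hasFDerivAt).comp x
      (differentiableAt_comp_extChartAt_symm hu hx).hasFDerivAt).fderiv
    rw [partialDeriv_eq_fderiv]
    exact congrArg (fun L : Plane →L[ℝ] ℝ => L (EuclideanSpace.single i 1)) this
  unfold wedge
  rw [h hu, h hu, h hw, h hw]

/-- The coordinates of `∂₁ X × ∂₂ X`, each of which is a `2`-form on `M`. -/
def crossForm (f : M → Space) (q : M) (x : Plane) : Fin 3 → ℝ :=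
  ![wedge (fun p => EuclideanSpace.proj (𝕜 := ℝ) 1 (f p))
      (fun p => EuclideanSpace.proj (𝕜 := ℝ) 2 (f p)) q x,
    wedge (fun p => EuclideanSpace.proj (𝕜 := ℝ) 2 (f p))
      (fun p => EuclideanSpace.proj (𝕜 := ℝ) 0 (f p)) q x,
    wedge (fun p => EuclideanSpace.proj (𝕜 := ℝ) 0 (f p))
      (fun p => EuclideanSpace.proj (𝕜 := ℝ) 1 (f p)) q x]

/-- The oriented area form `det (∂₁ X, ∂₂ X, N)`. -/
def areaForm (f N : M → Space) (q : M) (x : Plane) : ℝ :=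
  (N ((extChartAt (𝓡 2) q).symm x)).ofLp ⬝ᵥ crossForm f q x

theorem contMDiff_clm_comp {f : M → Space} (hf : ContMDiff (𝓡 2) 𝓘(ℝ, Space) ∞ f)
    (ℓ : Space →L[ℝ] ℝ) : ContMDiff (𝓡 2) 𝓘(ℝ, ℝ) ∞ fun p => ℓ (f p) :=
  ℓ.contMDiff.comp hf

theorem dotProduct_self_of_isGaussMap {f N : M → Space}
    (hN : IsGaussMap (𝓡 2) f N) (p : M) :
    (N p).ofLp ⬝ᵥ (N p).ofLp = 1 := by
  rw [← inner_eq_dotProduct, real_inner_self_eq_norm_sq, (hN.isUnitNormalAt p).norm_eq_one,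
    one_pow]

/-- A continuous nowhere vanishing `2`-form orients the surface. -/
theorem isOrientation_of_isTwoForm {β : M → Plane → ℝ} (hβ : IsTwoForm β)
    (hc : ∀ q, ContinuousOn (β q) (extChartAt (𝓡 2) q).target)
    (h0 : ∀ q, ∀ x ∈ (extChartAt (𝓡 2) q).target, β q x ≠ 0) :
    IsOrientation fun q x => β q x / |β q x| := by
  refine ⟨fun q x hx => ?_, fun q r x hx => ?_⟩
  · have hcx := (hc q).continuousAt ((isOpen_extChartAt_target q).mem_nhds hx)
    rcases lt_or_gt_of_ne (h0 q x hx) with h | h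
    · filter_upwards [hcx.eventually (gt_mem_nhds h)] with y hy
      rw [abs_of_neg hy, abs_of_neg h, div_neg_self hy.ne, div_neg_self h.ne]
    · filter_upwards [hcx.eventually (lt_mem_nhds h)] with y hy
      rw [abs_of_pos hy, abs_of_pos h, div_self hy.ne', div_self h.ne']
  · have h1 := h0 q x hx.1
    have h2 := h0 r _ (mem_overlap_swap hx).1
    rw [hβ q r x hx] at h1 ⊢
    have h3 := right_ne_zero_of_mul h1
    rw [abs_mul]
    have h4 := abs_ne_zero.2 h2
    have h5 := abs_ne_zero.2 h3
    field_simp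
    rw [sq_abs]

variable [IsManifold (𝓡 2) ∞ M]

theorem crossForm_eq_cross {f : M → Space} (hf : ContMDiff (𝓡 2) 𝓘(ℝ, Space) ∞ f) {q : M}
    {x : Plane} (hx : x ∈ (extChartAt (𝓡 2) q).target) :
    crossForm f q x =
      (partialDeriv (𝓡 2) f q 0 x).ofLp ⨯₃ (partialDeriv (𝓡 2) f q 1 x).ofLp := by
  rw [crossForm, wedge_clm_comp hf hf _ _ hx, wedge_clm_comp hf hf _ _ hx,
    wedge_clm_comp hf hf _ _ hx, cross_apply]
  ext k
  fin_cases k <;> simp <;> ring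

theorem isTwoForm_crossForm {f : M → Space} (hf : ContMDiff (𝓡 2) 𝓘(ℝ, Space) ∞ f) (k : Fin 3) :
    IsTwoForm fun q x => crossForm f q x k := by
  fin_cases k <;>
    exact isTwoForm_wedge (contMDiff_clm_comp hf _) (contMDiff_clm_comp hf _)

theorem isTwoForm_areaForm {f : M → Space} (hf : ContMDiff (𝓡 2) 𝓘(ℝ, Space) ∞ f)
    (N : M → Space) : IsTwoForm (areaForm f N) := by
  have h := (((isTwoForm_crossForm hf 0).const_mul fun p => N p 0).add
    ((isTwoForm_crossForm hf 1).const_mul fun p => N p 1)).add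
    ((isTwoForm_crossForm hf 2).const_mul fun p => N p 2)
  convert h using 2 with q
  ext x
  rw [areaForm, dotProduct, Fin.sum_univ_three]

theorem contDiffOn_crossForm {f : M → Space} (hf : ContMDiff (𝓡 2) 𝓘(ℝ, Space) ∞ f) (q : M)
    (k : Fin 3) :
    ContDiffOn ℝ ∞ (fun x => crossForm f q x k) (extChartAt (𝓡 2) q).target := by
  fin_cases k <;>
    exact contDiffOn_wedge (contMDiff_clm_comp hf _) (contMDiff_clm_comp hf _) q

theorem continuousOn_areaForm {f N : M → Space} (hf : ContMDiff (𝓡 2) 𝓘(ℝ, Space) ∞ f)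
    (hN : Continuous N) (q : M) :
    ContinuousOn (areaForm f N q) (extChartAt (𝓡 2) q).target := by
  have hNk (k : Fin 3) : ContinuousOn (fun x => N ((extChartAt (𝓡 2) q).symm x) k)
      (extChartAt (𝓡 2) q).target :=
    ((EuclideanSpace.proj (𝕜 := ℝ) k).continuous.comp hN).comp_continuousOn
      (continuousOn_extChartAt_symm q)
  unfold areaForm dotProduct
  exact continuousOn_finsetSum _ fun k _ => (hNk k).mul (contDiffOn_crossForm hf q k).continuousOn

variable {f N : M → Space}

/-- The Gauss map is normal to the differential, which is computed in the chart preferred at the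
point; the chain rule transfers this to the chart at q. -/
theorem partialDeriv_dotProduct_eq_zero (hf : ContMDiff (𝓡 2) 𝓘(ℝ, Space) ∞ f)
    (hN : IsGaussMap (𝓡 2) f N) {q : M} (i : Fin 2) {x : Plane}
    (hx : x ∈ (extChartAt (𝓡 2) q).target) :
    (partialDeriv (𝓡 2) f q i x).ofLp ⬝ᵥ (N ((extChartAt (𝓡 2) q).symm x)).ofLp = 0 := by
  rw [← inner_eq_dotProduct, partialDeriv_eq_fderiv,
    fderiv_comp_extChartAt_symm hf (mem_overlap_self hx)]
  have h := (hN.isUnitNormalAt ((extChartAt (𝓡 2) q).symm x)).orthogonal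
  rw [differential_eq_fderivWithin hf, (𝓡 2).range_eq_univ, fderivWithin_univ] at h
  exact h _

theorem crossForm_eq_areaForm_smul (hf : ContMDiff (𝓡 2) 𝓘(ℝ, Space) ∞ f)
    (hN : IsGaussMap (𝓡 2) f N) {q : M} {x : Plane} (hx : x ∈ (extChartAt (𝓡 2) q).target) :
    crossForm f q x = areaForm f N q x • (N ((extChartAt (𝓡 2) q).symm x)).ofLp := by
  rw [areaForm, crossForm_eq_cross hf hx]
  exact cross_eq_smul (dotProduct_self_of_isGaussMap hN _)
    (partialDeriv_dotProduct_eq_zero hf hN 0 hx) (partialDeriv_dotProduct_eq_zero hf hN 1 hx)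

/-- As ∂₁X × ∂₂X = J N, a zero of J would make the coordinate vectors dependent. -/
theorem areaForm_ne_zero (hf : ContMDiff (𝓡 2) 𝓘(ℝ, Space) ∞ f)
    (hinj : ∀ p, Function.Injective (differential (𝓡 2) f p)) (hN : IsGaussMap (𝓡 2) f N)
    {q : M} {x : Plane} (hx : x ∈ (extChartAt (𝓡 2) q).target) : areaForm f N q x ≠ 0 := by
  refine (isTwoForm_areaForm hf N).ne_zero (fun p h0 => ?_) hx
  have h := crossForm_eq_areaForm_smul hf hN (mem_extChartAt_target (I := 𝓡 2) p)
  rw [h0, zero_smul, crossForm_eq_cross hf (mem_extChartAt_target p)] at h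
  exact cross_partialDeriv_ne_zero hf (hinj p) h

/-- A continuous unit normal of a smooth immersion is smooth. -/
theorem IsGaussMap.contMDiff (hf : ContMDiff (𝓡 2) 𝓘(ℝ, Space) ∞ f)
    (hinj : ∀ p, Function.Injective (differential (𝓡 2) f p)) (hN : IsGaussMap (𝓡 2) f N) :
    ContMDiff (𝓡 2) 𝓘(ℝ, Space) ∞ N := by
  have hJ0 (q : M) (x : Plane) (hx : x ∈ (extChartAt (𝓡 2) q).target) :
      areaForm f N q x ≠ 0 := areaForm_ne_zero hf hinj hN hx
  have ho := isOrientation_of_isTwoForm (isTwoForm_areaForm hf N)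
    (continuousOn_areaForm hf hN.continuous) hJ0
  intro p
  set x₀ := extChartAt (𝓡 2) p p
  have hx₀ : x₀ ∈ (extChartAt (𝓡 2) p).target := mem_extChartAt_target p
  have hV := (isOpen_extChartAt_target (I := 𝓡 2) p).mem_nhds hx₀
  have hc (k : Fin 3) : ContDiffAt ℝ ∞ (fun x => crossForm f p x k) x₀ :=
    (contDiffOn_crossForm hf p k).contDiffAt hV
  -- J is defined through N, so its smoothness is not yet known. But S = |∂₁X × ∂₂X|² = J² is smooth
  -- and positive near the point, and J has locally constant sign, so J = ±√S is smooth, and so is N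
  -- = (∂₁X × ∂₂X) / J.
  set S : Plane → ℝ := fun x => ∑ k, crossForm f p x k * crossForm f p x k with hS
  have hSJ {x : Plane} (hx : x ∈ (extChartAt (𝓡 2) p).target) : S x = areaForm f N p x ^ 2 := by
    have : S x = crossForm f p x ⬝ᵥ crossForm f p x := rfl
    rw [this, crossForm_eq_areaForm_smul hf hN hx, smul_dotProduct, dotProduct_smul,
      dotProduct_self_of_isGaussMap hN, smul_eq_mul, smul_eq_mul, mul_one, sq]
  have hSd : ContDiffAt ℝ ∞ S x₀ := ContDiffAt.sum fun k _ => (hc k).mul (hc k)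
  have hS0 : S x₀ ≠ 0 := by
    rw [hSJ hx₀]
    exact pow_ne_zero 2 (hJ0 p x₀ hx₀)
  have hJ : ContDiffAt ℝ ∞ (areaForm f N p) x₀ := by
    have h : areaForm f N p =ᶠ[𝓝 x₀]
        fun x => areaForm f N p x₀ / |areaForm f N p x₀| * Real.sqrt (S x) := by
      filter_upwards [hV, ho.eventually_eq p x₀ hx₀] with x hx hox
      rw [← hox, hSJ hx, Real.sqrt_sq_eq_abs,
        div_mul_cancel₀ _ (abs_ne_zero.2 (hJ0 p x hx))]
    exact (contDiffAt_const.mul (hSd.sqrt hS0)).congr_of_eventuallyEq h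
  have hNx : ContDiffAt ℝ ∞ (N ∘ (extChartAt (𝓡 2) p).symm) x₀ := by
    rw [contDiffAt_euclidean]
    intro k
    refine ((hc k).div hJ (hJ0 p x₀ hx₀)).congr_of_eventuallyEq ?_
    filter_upwards [hV] with x hx
    rw [Pi.div_apply, crossForm_eq_areaForm_smul hf hN hx, Pi.smul_apply, smul_eq_mul,
      mul_div_cancel_left₀ _ (hJ0 p x hx)]
    rfl
  refine (hNx.contMDiffAt.comp p (contMDiffAt_extChartAt (I := 𝓡 2) (n := ∞))).congr_of_eventuallyEq
    ?_
  filter_upwards [extChartAt_source_mem_nhds (I := 𝓡 2) p] with y hy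
  exact congrArg N ((extChartAt (𝓡 2) p).left_inv hy).symm

end AreaForm

/-! ### The integral identity for the height of the normal -/

/-- The coordinate functions of `v ↦ a × v`. -/
def crossCLM (a : Space) : Fin 3 → Space →L[ℝ] ℝ :=
  ![a 1 • EuclideanSpace.proj 2 - a 2 • EuclideanSpace.proj 1,
    a 2 • EuclideanSpace.proj 0 - a 0 • EuclideanSpace.proj 2,
    a 0 • EuclideanSpace.proj 1 - a 1 • EuclideanSpace.proj 0]

/-- Cyclic symmetry of the triple product. It splits a · (dN × df) into scalar forms du ∧ dw, to
which Stokes applies. -/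
theorem sum_crossCLM_mul (a v w : Space) :
    ∑ k, crossCLM a k v * EuclideanSpace.proj (𝕜 := ℝ) k w =
      a.ofLp ⬝ᵥ (v.ofLp ⨯₃ w.ofLp) := by
  simp [crossCLM, Fin.sum_univ_three, dotProduct, cross_apply]
  ring

section Identity

variable {M : Type*} [TopologicalSpace M] [ChartedSpace Plane M]
  [IsManifold (𝓡 2) ∞ M] {f N : M → Space}

/-- The Weingarten equations `⟪∂ⱼ ∂ᵢ X, N⟫ = -⟪∂ᵢ X, ∂ⱼ N⟫`. -/
theorem secondForm_eq_neg_dotProduct (hf : ContMDiff (𝓡 2) 𝓘(ℝ, Space) ∞ f)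
    (hN : IsGaussMap (𝓡 2) f N) (hNs : ContMDiff (𝓡 2) 𝓘(ℝ, Space) ∞ N) (p : M) (i j : Fin 2) :
    secondForm (𝓡 2) f p (N p) i j =
      -((partialDeriv (𝓡 2) f p i (extChartAt (𝓡 2) p p)).ofLp ⬝ᵥ
        (partialDeriv (𝓡 2) N p j (extChartAt (𝓡 2) p p)).ofLp) := by
  set x₀ := extChartAt (𝓡 2) p p with hx₀
  have hxt : x₀ ∈ (extChartAt (𝓡 2) p).target := mem_extChartAt_target p
  have hV := (isOpen_extChartAt_target (I := 𝓡 2) p).mem_nhds hxt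
  have hd : DifferentiableAt ℝ (partialDeriv (𝓡 2) f p i) x₀ := by
    have h : partialDeriv (𝓡 2) f p i = fun x =>
        fderiv ℝ (f ∘ (extChartAt (𝓡 2) p).symm) x (EuclideanSpace.single i 1) :=
      funext fun x => partialDeriv_eq_fderiv f p i x
    rw [h]
    exact ((((contDiffOn_comp_extChartAt_symm hf p).fderiv_of_isOpen (m := ∞)
      (isOpen_extChartAt_target p) (by simp)).clm_apply contDiffOn_const).contDiffAt
        hV).differentiableAt (by simp)
  have hNd := differentiableAt_comp_extChartAt_symm hNs hxt
  have h0 : (fun x => inner ℝ (partialDeriv (𝓡 2) f p i x) ((N ∘ (extChartAt (𝓡 2) p).symm) x))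
      =ᶠ[𝓝 x₀] fun _ => (0 : ℝ) := by
    filter_upwards [hV] with x hx
    rw [inner_eq_dotProduct]
    exact partialDeriv_dotProduct_eq_zero hf hN i hx
  have h1 := fderiv_inner_apply ℝ hd hNd (EuclideanSpace.single j 1)
  rw [h0.fderiv_eq] at h1
  have hNp : (N ∘ (extChartAt (𝓡 2) p).symm) x₀ = N p := by
    rw [Function.comp_apply, hx₀, extChartAt_to_inv]
  have h2 : partialDeriv₂ (𝓡 2) f p i j =
      fderiv ℝ (partialDeriv (𝓡 2) f p i) x₀ (EuclideanSpace.single j 1) := by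
    rw [partialDeriv₂, (𝓡 2).range_eq_univ, fderivWithin_univ]
  rw [hNp, ← h2, ← partialDeriv_eq_fderiv, inner_eq_dotProduct] at h1
  simp only [fderiv_fun_const, Pi.zero_apply, _root_.zero_apply] at h1
  rw [secondForm, Matrix.of_apply]
  linarith

theorem partialDeriv_normal_dotProduct_eq_zero (hN : IsGaussMap (𝓡 2) f N)
    (hNs : ContMDiff (𝓡 2) 𝓘(ℝ, Space) ∞ N) (p : M) (j : Fin 2) :
    (partialDeriv (𝓡 2) N p j (extChartAt (𝓡 2) p p)).ofLp ⬝ᵥ (N p).ofLp = 0 := by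
  have hxt := mem_extChartAt_target (I := 𝓡 2) p
  have hNd := differentiableAt_comp_extChartAt_symm hNs hxt
  have h1 := fderiv_inner_apply ℝ hNd hNd (EuclideanSpace.single j 1)
  have h0 : (fun x => inner ℝ ((N ∘ (extChartAt (𝓡 2) p).symm) x)
      ((N ∘ (extChartAt (𝓡 2) p).symm) x)) = fun _ => (1 : ℝ) := by
    ext x
    rw [inner_eq_dotProduct]
    exact dotProduct_self_of_isGaussMap hN _
  rw [h0, real_inner_comm, ← partialDeriv_eq_fderiv, Function.comp_apply, extChartAt_to_inv,
    inner_eq_dotProduct] at h1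
  simp only [fderiv_fun_const, Pi.zero_apply, _root_.zero_apply] at h1
  linarith

/-- The identity `∑ₖ d(a × (N + c f))ₖ ∧ dfₖ = -(α ⟪N, a⟫² / ⟪f, a⟫) dA` at the points with
`H_φ = c`. -/
theorem sum_wedge_eq_of_weightedMeanCurvature_eq (hf : ContMDiff (𝓡 2) 𝓘(ℝ, Space) ∞ f)
    (hinj : ∀ p, Function.Injective (differential (𝓡 2) f p)) (hN : IsGaussMap (𝓡 2) f N)
    {α c : ℝ} {a : Space} {p : M} (hp : 0 < inner ℝ (f p) a)
    (hc : weightedMeanCurvature (𝓡 2) α a f p (N p) = c) :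
    ∑ k, wedge (fun q => crossCLM a k (N q + c • f q))
        (fun q => EuclideanSpace.proj (𝕜 := ℝ) k (f q)) p (extChartAt (𝓡 2) p p) =
      -(α * inner ℝ (N p) a ^ 2 / inner ℝ (f p) a) *
        areaForm f N p (extChartAt (𝓡 2) p p) := by
  have hNs := hN.contMDiff hf hinj
  have hG : ContMDiff (𝓡 2) 𝓘(ℝ, Space) ∞ fun q => N q + c • f q :=
    hNs.add ((c • ContinuousLinearMap.id ℝ Space).contMDiff.comp hf)
  set x₀ := extChartAt (𝓡 2) p p with hx₀
  have hxt : x₀ ∈ (extChartAt (𝓡 2) p).target := mem_extChartAt_target p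
  have hGd (i : Fin 2) : partialDeriv (𝓡 2) (fun q => N q + c • f q) p i x₀ =
      partialDeriv (𝓡 2) N p i x₀ + c • partialDeriv (𝓡 2) f p i x₀ := by
    have h := ((differentiableAt_comp_extChartAt_symm hNs hxt).hasFDerivAt.add
      ((differentiableAt_comp_extChartAt_symm hf hxt).hasFDerivAt.const_smul c)).fderiv
    rw [partialDeriv_eq_fderiv, partialDeriv_eq_fderiv, partialDeriv_eq_fderiv]
    exact congrArg (fun L : Plane →L[ℝ] Space => L (EuclideanSpace.single i 1)) h
  have hJ := areaForm_ne_zero hf hinj hN hxt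
  have hsym : (extChartAt (𝓡 2) p).symm x₀ = p := extChartAt_to_inv p
  have hX := partialDeriv_dotProduct_eq_zero hf hN 0 hxt
  have hY := partialDeriv_dotProduct_eq_zero hf hN 1 hxt
  have hP := partialDeriv_normal_dotProduct_eq_zero hN hNs p 0
  have hQ := partialDeriv_normal_dotProduct_eq_zero hN hNs p 1
  have hn := dotProduct_self_of_isGaussMap hN p
  have hJeq : areaForm f N p x₀ = (N p).ofLp ⬝ᵥ
      ((partialDeriv (𝓡 2) f p 0 x₀).ofLp ⨯₃ (partialDeriv (𝓡 2) f p 1 x₀).ofLp) := by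
    rw [areaForm, crossForm_eq_cross hf hxt, hsym]
  rw [hsym] at hX hY
  have hcross := cross_eq_smul hn hX hY
  have hJsq := sq_dotProduct_cross hn hX hY
  have hdiff := mul_sub_eq_of_tangent a.ofLp hn hX hY hP hQ
  rw [← hJeq] at hcross hJsq hdiff
  have hg (i j : Fin 2) : firstForm (𝓡 2) f p i j = (partialDeriv (𝓡 2) f p i x₀).ofLp ⬝ᵥ
      (partialDeriv (𝓡 2) f p j x₀).ofLp := by
    rw [firstForm, Matrix.of_apply, inner_eq_dotProduct]
  have hdet : (firstForm (𝓡 2) f p).det = areaForm f N p x₀ ^ 2 := by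
    rw [Matrix.det_fin_two, hg, hg, hg, hg, hJsq, dotProduct_comm (partialDeriv (𝓡 2) f p 1 x₀).ofLp
      (partialDeriv (𝓡 2) f p 0 x₀).ofLp]
  rw [weightedMeanCurvature, meanCurvature, trace_nonsing_inv_mul, hdet] at hc
  simp only [hg, secondForm_eq_neg_dotProduct hf hN hNs] at hc
  simp only [wedge_clm_comp hG hf _ _ hxt, hGd]
  -- By `hdiff` the derivatives of N contribute -2H ⟨N, a⟩ J. The f terms contribute 2c ⟨N, a⟩ J by
  -- antisymmetry of the cross product, and `hc` evaluates H - c.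
  rw [Finset.sum_sub_distrib, sum_crossCLM_mul, sum_crossCLM_mul]
  rw [inner_eq_dotProduct] at hp hc ⊢
  rw [inner_eq_dotProduct] at hc ⊢
  simp only [WithLp.ofLp_add, WithLp.ofLp_smul, map_add, map_smul, LinearMap.add_apply,
    LinearMap.smul_apply, dotProduct_add, dotProduct_smul, smul_eq_mul]
  rw [← cross_anticomm (partialDeriv (𝓡 2) f p 0 x₀).ofLp (partialDeriv (𝓡 2) f p 1 x₀).ofLp,
    dotProduct_neg, hcross, dotProduct_smul, smul_eq_mul]
  rw [← hx₀] at hdiff hc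
  rw [dotProduct_comm (N p).ofLp a.ofLp] at hc ⊢
  rw [dotProduct_comm (partialDeriv (𝓡 2) N p 0 x₀).ofLp (partialDeriv (𝓡 2) f p 0 x₀).ofLp,
    dotProduct_comm (partialDeriv (𝓡 2) N p 0 x₀).ofLp (partialDeriv (𝓡 2) f p 1 x₀).ofLp,
    dotProduct_comm (partialDeriv (𝓡 2) N p 1 x₀).ofLp (partialDeriv (𝓡 2) f p 0 x₀).ofLp,
    dotProduct_comm (partialDeriv (𝓡 2) N p 1 x₀).ofLp (partialDeriv (𝓡 2) f p 1 x₀).ofLp]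
    at hdiff
  rw [dotProduct_comm (partialDeriv (𝓡 2) f p 1 x₀).ofLp (partialDeriv (𝓡 2) f p 0 x₀).ofLp] at hc
  generalize areaForm f N p x₀ = J at *
  generalize a.ofLp ⬝ᵥ (N p).ofLp = A at *
  generalize (f p).ofLp ⬝ᵥ a.ofLp = h at *
  have hp' := hp.ne'
  field_simp at hc ⊢
  refine mul_left_cancel₀ hJ ?_
  linear_combination h * hdiff - A * hc

end Identity

/-! ### The maximum principle at interior points -/

/-- The second derivative is nonpositive at a local maximum. -/
theorem deriv_deriv_nonpos_of_isLocalMax {φ : ℝ → ℝ} {t : ℝ} (h : IsLocalMax φ t)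
    (hc : ContinuousAt φ t) : deriv (deriv φ) t ≤ 0 := by
  by_contra! hpos
  -- A positive second derivative would make t a local minimum too, hence φ locally constant.
  have hmin := isLocalMin_of_deriv_deriv_pos hpos h.deriv_eq_zero hc
  have hconst : φ =ᶠ[𝓝 t] fun _ => φ t := by
    filter_upwards [h, hmin] with s h1 h2 using le_antisymm h1 h2
  rw [hconst.deriv.deriv_eq] at hpos
  simp at hpos

/-- Reduction to one variable along the line t ↦ x + t v. -/
theorem inner_fderiv_fderiv_nonpos_of_max {E F : Type*} [NormedAddCommGroup E] [NormedSpace ℝ E]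
    [NormedAddCommGroup F] [InnerProductSpace ℝ F] {Y : E → F} {x : E}
    (hY : ContDiffAt ℝ ∞ Y x) (v : E) {b : F}
    (hmax : ∀ y, (inner ℝ (Y y) b : ℝ) ≤ inner ℝ (Y x) b) :
    inner ℝ (fderiv ℝ (fderiv ℝ Y) x v v) b ≤ 0 := by
  have hd : DifferentiableAt ℝ (fderiv ℝ Y) x :=
    (hY.fderiv_right (m := ∞) (by simp)).differentiableAt (by simp)
  have hline (t : ℝ) : HasDerivAt (fun t : ℝ => x + t • v) v t := by
    simpa using ((hasDerivAt_id t).smul_const v).const_add x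
  have hline0 : x + (0 : ℝ) • v = x := by simp
  have hev : ∀ᶠ y in 𝓝 x, DifferentiableAt ℝ Y y := by
    have h1 : ContDiffAt ℝ 1 Y x := hY.of_le (by simp)
    filter_upwards [h1.eventually (by simp)] with y hy using hy.differentiableAt (by simp)
  have hev' : ∀ᶠ t : ℝ in 𝓝 0, DifferentiableAt ℝ Y (x + t • v) := by
    have hc : Tendsto (fun t : ℝ => x + t • v) (𝓝 0) (𝓝 x) := by
      have := (hline 0).continuousAt.tendsto
      rwa [hline0] at this
    exact hc.eventually hev
  have hφd {t : ℝ} (ht : DifferentiableAt ℝ Y (x + t • v)) :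
      HasDerivAt (fun t : ℝ => (inner ℝ (Y (x + t • v)) b : ℝ))
        (inner ℝ (fderiv ℝ Y (x + t • v) v) b) t := by
    have h := (ht.hasFDerivAt.comp_hasDerivAt t (hline t)).inner ℝ (hasDerivAt_const t b)
    rw [inner_zero_right, zero_add] at h
    exact h
  have hφ1 : deriv (fun t : ℝ => (inner ℝ (Y (x + t • v)) b : ℝ)) =ᶠ[𝓝 0]
      fun t => inner ℝ (fderiv ℝ Y (x + t • v) v) b := by
    filter_upwards [hev'] with t ht using (hφd ht).deriv
  have hφ2 : deriv (deriv fun t : ℝ => (inner ℝ (Y (x + t • v)) b : ℝ)) 0 =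
      inner ℝ (fderiv ℝ (fderiv ℝ Y) x v v) b := by
    rw [hφ1.deriv_eq]
    have hd' : HasFDerivAt (fderiv ℝ Y) (fderiv ℝ (fderiv ℝ Y) x) (x + (0 : ℝ) • v) := by
      rw [hline0]
      exact hd.hasFDerivAt
    have h1 : HasDerivAt (fun t : ℝ => fderiv ℝ Y (x + t • v)) (fderiv ℝ (fderiv ℝ Y) x v) 0 :=
      hd'.comp_hasDerivAt (0 : ℝ) (hline 0)
    have h2 := (h1.clm_apply (hasDerivAt_const (0 : ℝ) v)).inner ℝ (hasDerivAt_const (0 : ℝ) b)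
    rw [inner_zero_right, zero_add, map_zero, add_zero] at h2
    exact h2.deriv
  rw [← hφ2]
  refine deriv_deriv_nonpos_of_isLocalMax (Eventually.of_forall fun t => ?_)
    (hφd hev'.self_of_nhds).continuousAt
  beta_reduce
  rw [hline0]
  exact hmax _

section Extremum

variable {H : Type*} [TopologicalSpace H] {I : ModelWithCorners ℝ Plane H}
  {M : Type*} [TopologicalSpace M] [ChartedSpace H M] [IsManifold I ∞ M] {f : M → Space} {p : M}

/-- The condition on `range I` says that p is an interior point, where derivatives within `range I`
are ordinary ones. This serves surfaces with and without boundary alike. -/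
theorem contDiffAt_localParam (hf : ContMDiff I 𝓘(ℝ, Space) ∞ f)
    (hp : range I ∈ 𝓝 (extChartAt I p p)) :
    ContDiffAt ℝ ∞ (localParam I f p) (extChartAt I p p) := by
  have h : ContDiffOn ℝ ∞ (localParam I f p) (extChartAt I p).target :=
    contMDiffOn_iff_contDiffOn.1 (hf.comp_contMDiffOn (contMDiffOn_extChartAt_symm p))
  refine h.contDiffAt ?_
  rw [← nhdsWithin_eq_nhds.2 hp]
  exact extChartAt_target_mem_nhdsWithin p

/-- The tangent plane at an interior maximum point of `⟪f, b⟫` is orthogonal to `b`. -/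
theorem inner_differential_eq_zero_of_max (hf : ContMDiff I 𝓘(ℝ, Space) ∞ f)
    (hp : range I ∈ 𝓝 (extChartAt I p p)) {b : Space}
    (hmax : ∀ q, (inner ℝ (f q) b : ℝ) ≤ inner ℝ (f p) b) (v : Plane) :
    inner ℝ (differential I f p v) b = 0 := by
  have hd := (contDiffAt_localParam hf hp).differentiableAt (by simp)
  have hm : IsLocalMax (fun x => (inner ℝ (localParam I f p x) b : ℝ)) (extChartAt I p p) := by
    refine Eventually.of_forall fun x => ?_
    simp only [localParam, Function.comp_apply, extChartAt_to_inv]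
    exact hmax _
  have h := fderiv_inner_apply ℝ hd (differentiableAt_const b) v
  rw [hm.fderiv_eq_zero] at h
  simp only [fderiv_fun_const, Pi.zero_apply, _root_.zero_apply, inner_zero_right, zero_add] at h
  rw [differential_eq_fderivWithin hf, fderivWithin_of_mem_nhds hp]
  exact h.symm

theorem partialDeriv₂_eq_fderiv_fderiv (hf : ContMDiff I 𝓘(ℝ, Space) ∞ f)
    (hp : range I ∈ 𝓝 (extChartAt I p p)) (i j : Fin 2) :
    partialDeriv₂ I f p i j = fderiv ℝ (fderiv ℝ (localParam I f p)) (extChartAt I p p)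
      (EuclideanSpace.single j 1) (EuclideanSpace.single i 1) := by
  have hd : DifferentiableAt ℝ (fderiv ℝ (localParam I f p)) (extChartAt I p p) :=
    ((contDiffAt_localParam hf hp).fderiv_right (m := ∞) (by simp)).differentiableAt (by simp)
  have h : partialDeriv I f p i =ᶠ[𝓝 (extChartAt I p p)]
      fun x => fderiv ℝ (localParam I f p) x (EuclideanSpace.single i 1) := by
    filter_upwards [eventually_mem_nhds_iff.2 hp] with x hx
    rw [partialDeriv, fderivWithin_of_mem_nhds hx]
  rw [partialDeriv₂, fderivWithin_of_mem_nhds hp, h.fderiv_eq,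
    fderiv_clm_apply hd (differentiableAt_const _)]
  simp

/-- The second fundamental form with respect to `b` is negative semidefinite at an interior maximum
point of `⟪f, b⟫`. -/
theorem secondForm_nonpos_of_max (hf : ContMDiff I 𝓘(ℝ, Space) ∞ f)
    (hp : range I ∈ 𝓝 (extChartAt I p p)) {b : Space}
    (hmax : ∀ q, (inner ℝ (f q) b : ℝ) ≤ inner ℝ (f p) b) (r s : ℝ) :
    r ^ 2 * secondForm I f p b 0 0 + r * s * (secondForm I f p b 0 1 + secondForm I f p b 1 0) +
      s ^ 2 * secondForm I f p b 1 1 ≤ 0 := by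
  have hle := inner_fderiv_fderiv_nonpos_of_max (contDiffAt_localParam hf hp)
    (r • EuclideanSpace.single 0 1 + s • EuclideanSpace.single 1 1) (b := b) fun x => by
      simp only [localParam, Function.comp_apply, extChartAt_to_inv]
      exact hmax _
  simp only [secondForm, Matrix.of_apply, partialDeriv₂_eq_fderiv_fderiv hf hp]
  simp only [map_add, map_smul, _root_.add_apply, _root_.smul_apply, inner_add_left,
    inner_smul_left, RCLike.conj_to_real, smul_add, smul_smul] at hle
  linarith

/-- `H ≤ 0` with respect to `b` at an interior maximum point of `⟪f, b⟫`. -/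
theorem meanCurvature_nonpos_of_max (hf : ContMDiff I 𝓘(ℝ, Space) ∞ f)
    (hinj : Function.Injective (differential I f p)) (hp : range I ∈ 𝓝 (extChartAt I p p))
    {b : Space} (hmax : ∀ q, (inner ℝ (f q) b : ℝ) ≤ inner ℝ (f p) b) :
    meanCurvature I f p b ≤ 0 := by
  have hg (i j : Fin 2) : firstForm I f p i j =
      (partialDeriv I f p i (extChartAt I p p)).ofLp ⬝ᵥ
        (partialDeriv I f p j (extChartAt I p p)).ofLp := by
    rw [firstForm, Matrix.of_apply, inner_eq_dotProduct]
  have hsymm : firstForm I f p 1 0 = firstForm I f p 0 1 := by rw [hg, hg, dotProduct_comm]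
  have hdet : 0 < firstForm I f p 0 0 * firstForm I f p 1 1 - firstForm I f p 0 1 ^ 2 := by
    have h := cross_dot_cross (partialDeriv I f p 0 (extChartAt I p p)).ofLp
      (partialDeriv I f p 1 (extChartAt I p p)).ofLp
      (partialDeriv I f p 0 (extChartAt I p p)).ofLp
      (partialDeriv I f p 1 (extChartAt I p p)).ofLp
    rw [← hg, ← hg, ← hg, ← hg, hsymm, ← sq] at h
    rw [← h]
    refine lt_of_le_of_ne ?_ fun h0 => cross_partialDeriv_ne_zero hf hinj
      (dotProduct_self_eq_zero.1 h0.symm)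
    exact Finset.sum_nonneg fun i _ => mul_self_nonneg _
  have h00 : 0 < firstForm I f p 0 0 := by
    refine lt_of_le_of_ne ?_ fun h0 => ?_
    · rw [hg]
      exact Finset.sum_nonneg fun i _ => mul_self_nonneg _
    · rw [← h0] at hdet
      nlinarith [sq_nonneg (firstForm I f p 0 1)]
  have hS := secondForm_nonpos_of_max hf hp hmax
  -- The vector v = (g₀₁, -g₀₀) is g-orthogonal to e₀, and g₀₀ times the numerator of the trace is
  -- h(v, v) + det g · h₀₀.
  have h1 := hS (firstForm I f p 0 1) (-firstForm I f p 0 0)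
  have h2 := hS 1 0
  rw [meanCurvature, trace_nonsing_inv_mul, Matrix.det_fin_two, hsymm]
  refine div_nonpos_of_nonpos_of_nonneg (div_nonpos_of_nonpos_of_nonneg ?_ ?_) two_pos.le
  · refine nonpos_of_mul_nonpos_right ?_ h00
    nlinarith [mul_nonneg hdet.le (by linarith : 0 ≤ -secondForm I f p b 0 0)]
  · linarith [sq (firstForm I f p 0 1)]

end Extremum

theorem exists_forall_inner_le {M : Type*} [TopologicalSpace M] [CompactSpace M] [Nonempty M]
    {f : M → Space} (hf : Continuous f) (b : Space) :
    ∃ p, ∀ q, (inner ℝ (f q) b : ℝ) ≤ inner ℝ (f p) b := by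
  obtain ⟨p, -, hp⟩ := isCompact_univ.exists_isMaxOn univ_nonempty
    (hf.inner (𝕜 := ℝ) (continuous_const (y := b))).continuousOn
  exact ⟨p, fun q => hp (mem_univ q)⟩

/-! ### The two nonexistence results -/

/-- A compact singular minimal surface has a boundary point. -/
theorem IsSingularMinimal.boundary_nonempty {α : ℝ} (hα : α ≠ 0) {a : Space} (ha : ‖a‖ = 1)
    {H : Type*} [TopologicalSpace H] {I : ModelWithCorners ℝ Plane H}
    {M : Type*} [TopologicalSpace M] [CompactSpace M] [Nonempty M]
    [ChartedSpace H M] [IsManifold I ∞ M] {f : M → Space}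
    (h : IsSingularMinimal I α a f) : (I.boundary M).Nonempty := by
  by_contra hempty
  rw [not_nonempty_iff_eq_empty] at hempty
  have hint (p : M) : range I ∈ 𝓝 (extChartAt I p p) := by
    have hp : ¬I.IsBoundaryPoint p := fun hp => by
      have : p ∈ I.boundary M := hp
      rw [hempty] at this
      exact this
    exact mem_interior_iff_mem_nhds.1 ((I.isInteriorPoint_iff_not_isBoundaryPoint p).2 hp)
  have hf := h.isImmersion.contMDiff
  have haa : (inner ℝ a a : ℝ) = 1 := by rw [real_inner_self_eq_norm_sq, ha, one_pow]
  -- At a maximum of ⟨f, b⟩ the vector b is itself a unit normal, so the equation applies with ν = b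
  -- and no Gauss map is needed. The choices b = a and b = -a give opposite signs for α.
  have key {b : Space} (hb : ‖b‖ = 1) : ∃ p, α * inner ℝ b a / inner ℝ (f p) a ≤ 0 := by
    obtain ⟨p, hp⟩ := exists_forall_inner_le hf.continuous b
    have hn : IsUnitNormalAt I f p b :=
      ⟨hb, fun v => inner_differential_eq_zero_of_max hf (hint p) hp v⟩
    refine ⟨p, ?_⟩
    rw [← h.equation p b hn]
    linarith [meanCurvature_nonpos_of_max hf (h.isImmersion.injective_differential p) (hint p) hp]
  obtain ⟨p, hp⟩ := key ha
  obtain ⟨q, hq⟩ := key (b := -a) (by rw [norm_neg, ha])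
  have hp0 := h.isImmersion.height_pos p
  have hq0 := h.isImmersion.height_pos q
  rw [haa, div_le_iff₀ hp0] at hp
  rw [inner_neg_left, haa, div_le_iff₀ hq0] at hq
  exact hα (le_antisymm (by linarith) (by linarith))

/-- There is no closed oriented surface with constant weighted mean curvature. -/
theorem not_forall_weightedMeanCurvature_eq {α : ℝ} (hα : α ≠ 0) {a : Space} (ha : ‖a‖ = 1)
    {M : Type*} [TopologicalSpace M] [T2Space M] [CompactSpace M] [Nonempty M]
    [ChartedSpace Plane M] [IsManifold (𝓡 2) ∞ M] {f N : M → Space}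
    (him : IsImmersionInHalfSpace (𝓡 2) a f) (hN : IsGaussMap (𝓡 2) f N) (c : ℝ) :
    ¬ ∀ p, weightedMeanCurvature (𝓡 2) α a f p (N p) = c := by
  intro hc
  have hf := him.contMDiff
  have hinj := him.injective_differential
  have hNs := hN.contMDiff hf hinj
  have hJ0 (q : M) (x : Plane) (hx : x ∈ (extChartAt (𝓡 2) q).target) :
      areaForm f N q x ≠ 0 := areaForm_ne_zero hf hinj hN hx
  have hJc := continuousOn_areaForm hf hN.continuous
  have ho := isOrientation_of_isTwoForm (isTwoForm_areaForm hf N) hJc hJ0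
  obtain ⟨t, ρ, hρ⟩ := exists_isChartPartition M
  have hG : ContMDiff (𝓡 2) 𝓘(ℝ, Space) ∞ fun q => N q + c • f q :=
    hNs.add ((c • ContinuousLinearMap.id ℝ Space).contMDiff.comp hf)
  have hU (k : Fin 3) := contMDiff_clm_comp hG (crossCLM a k)
  have hW (k : Fin 3) := contMDiff_clm_comp hf (EuclideanSpace.proj (𝕜 := ℝ) k)
  set θ : Fin 3 → M → Plane → ℝ := fun k => wedge (fun q => crossCLM a k (N q + c • f q))
    (fun q => EuclideanSpace.proj (𝕜 := ℝ) k (f q)) with hθ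
  have htwo (k : Fin 3) : IsTwoForm (θ k) := isTwoForm_wedge (hU k) (hW k)
  set D : M → ℝ := fun p => inner ℝ (N p) a ^ 2 / inner ℝ (f p) a with hD
  have hDc : Continuous D := ((hN.continuous.inner continuous_const).pow 2).div
    (hf.continuous.inner continuous_const) fun p => (him.height_pos p).ne'
  have hD0 (p : M) : 0 ≤ D p := div_nonneg (sq_nonneg _) (him.height_pos p).le
  have hsum {q : M} {x : Plane} (hx : x ∈ (extChartAt (𝓡 2) q).target) :
      ∑ k, θ k q x = -(α * D ((extChartAt (𝓡 2) q).symm x)) * areaForm f N q x := by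
    have h3 : IsTwoForm fun q x => ∑ k, θ k q x := by
      simp only [Fin.sum_univ_three]
      exact ((htwo 0).add (htwo 1)).add (htwo 2)
    refine h3.eqOn ((isTwoForm_areaForm hf N).const_mul fun p => -(α * D p)) (fun p => ?_) q hx
    simp only [extChartAt_to_inv]
    rw [hθ, sum_wedge_eq_of_weightedMeanCurvature_eq hf hinj hN (him.height_pos p) (hc p), hD,
      mul_div_assoc]
  -- Multiplying J by its sign gives |J|, so the oriented integrand is -α F with F ≥ 0.
  set F : M → Plane → ℝ := fun j x => ρ j ((extChartAt (𝓡 2) j).symm x) *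
    (D ((extChartAt (𝓡 2) j).symm x) * |areaForm f N j x|) with hF
  have hρc (j : M) : ContinuousOn (fun x => ρ j ((extChartAt (𝓡 2) j).symm x))
      (extChartAt (𝓡 2) j).target :=
    (hρ.contMDiff j).continuous.comp_continuousOn (continuousOn_extChartAt_symm j)
  have hFc (j : M) : ContinuousOn (F j) (extChartAt (𝓡 2) j).target :=
    (hρc j).mul ((hDc.comp_continuousOn (continuousOn_extChartAt_symm j)).mul (hJc j).abs)
  have hF0 (j : M) (x : Plane) : 0 ≤ F j x :=
    mul_nonneg (hρ.nonneg _ _) (mul_nonneg (hD0 _) (abs_nonneg _))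
  have hFi (j : M) : IntegrableOn (F j) (extChartAt (𝓡 2) j).target := by
    refine integrableOn_target (isClosed_tsupport _) (hρ.tsupport_subset j) (hFc j) ?_
    intro x _ hxs
    rw [hF]
    simp only
    rw [image_eq_zero_of_notMem_tsupport hxs, zero_mul]
  have hstokes : ∑ j ∈ t, ∫ x in (extChartAt (𝓡 2) j).target, -α * F j x = 0 := by
    have h0 : ∑ k : Fin 3, ∑ j ∈ t, ∫ x in (extChartAt (𝓡 2) j).target,
        areaForm f N j x / |areaForm f N j x| *
          (ρ j ((extChartAt (𝓡 2) j).symm x) * θ k j x) = 0 :=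
      Finset.sum_eq_zero fun k _ => sum_setIntegral_wedge_eq_zero ho hρ (hU k) (hW k)
    rw [Finset.sum_comm] at h0
    rw [← h0]
    refine Finset.sum_congr rfl fun j _ => ?_
    rw [← integral_finsetSum]
    · refine setIntegral_congr_fun (isOpen_extChartAt_target j).measurableSet fun x hx => ?_
      rw [← Finset.mul_sum, ← Finset.mul_sum, hsum hx, hF]
      have h1 := abs_ne_zero.2 (hJ0 j x hx)
      field_simp
      rw [sq_abs]
    · intro k _
      refine integrableOn_target (isClosed_tsupport _) (hρ.tsupport_subset j)
        ((ho.continuousOn j).mul ((hρc j).mul (contDiffOn_wedge (hU k) (hW k) j).continuousOn)) ?_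
      intro x _ hxs
      rw [image_eq_zero_of_notMem_tsupport hxs, zero_mul, mul_zero]
  simp only [integral_const_mul] at hstokes
  rw [← Finset.mul_sum, mul_eq_zero, or_iff_right (neg_ne_zero.2 hα),
    Finset.sum_eq_zero_iff_of_nonneg fun j _ => integral_nonneg (hF0 j)] at hstokes
  obtain ⟨p, hp⟩ := exists_forall_inner_le hf.continuous a
  -- Each F j has zero integral, so it vanishes almost everywhere and, by continuity, on the whole
  -- open target. Some ρ j is nonzero at the highest point p, and J ≠ 0.
  have hDp : D p = 0 := by
    obtain ⟨j, hj, hjp⟩ : ∃ j ∈ t, ρ j p ≠ 0 := by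
      by_contra! hall
      have h1 := hρ.sum_eq_one p
      rw [Finset.sum_eq_zero hall] at h1
      exact zero_ne_one h1
    have hsrc : p ∈ (extChartAt (𝓡 2) j).source :=
      hρ.tsupport_subset j (subset_tsupport _ hjp)
    have hz := (setIntegral_eq_zero_iff_of_nonneg_ae
      (Eventually.of_forall (hF0 j)) (hFi j)).1 (hstokes j hj)
    have hEq := Measure.eqOn_open_of_ae_eq hz (isOpen_extChartAt_target j) (hFc j)
      continuousOn_const
    have hx := (extChartAt (𝓡 2) j).map_source hsrc
    have hFx : F j (extChartAt (𝓡 2) j p) = 0 := hEq hx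
    simp only [hF] at hFx
    rw [(extChartAt (𝓡 2) j).left_inv hsrc] at hFx
    exact (mul_eq_zero.1 ((mul_eq_zero.1 hFx).resolve_left hjp)).resolve_right
      (abs_ne_zero.2 (hJ0 j _ hx))
  have hNa : (inner ℝ (N p) a : ℝ) = 0 := by
    rw [hD, div_eq_zero_iff, or_iff_left (him.height_pos p).ne'] at hDp
    exact pow_eq_zero_iff two_ne_zero |>.1 hDp
  have hrange : range (𝓡 2) ∈ 𝓝 (extChartAt (𝓡 2) p p) := by
    rw [(𝓡 2).range_eq_univ]
    exact univ_mem
  have horth (i : Fin 2) :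
      (partialDeriv (𝓡 2) f p i (extChartAt (𝓡 2) p p)).ofLp ⬝ᵥ a.ofLp = 0 := by
    rw [← inner_eq_dotProduct, partialDeriv, ← differential_eq_fderivWithin hf]
    exact inner_differential_eq_zero_of_max hf hrange hp _
  have haa : a.ofLp ⬝ᵥ a.ofLp = 1 := by
    rw [← inner_eq_dotProduct, real_inner_self_eq_norm_sq, ha, one_pow]
  have hxt := mem_extChartAt_target (I := 𝓡 2) p
  -- At p the product ∂₁X × ∂₂X is a multiple of a, so J is a multiple of ⟨N, a⟩ = 0.
  refine hJ0 p _ hxt ?_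
  rw [areaForm, crossForm_eq_cross hf hxt, cross_eq_smul haa (horth 0) (horth 1), dotProduct_smul,
    extChartAt_to_inv, ← inner_eq_dotProduct (N p) a, hNa, smul_zero]

end WeightedSurface

end

theorem proposition2p5 (α : ℝ) (hα : α ≠ 0)
    (a : WeightedSurface.Space) (ha : ‖a‖ = 1) :
    (∀ (M : Type*) [TopologicalSpace M] [T2Space M] [CompactSpace M] [Nonempty M]
        [ChartedSpace (EuclideanSpace ℝ (Fin 2)) M] [IsManifold (𝓡 2) ∞ M],
      ¬ ∃ (f : M → WeightedSurface.Space) (N : M → WeightedSurface.Space) (c : ℝ),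
          WeightedSurface.IsImmersionInHalfSpace (𝓡 2) a f ∧
          WeightedSurface.IsGaussMap (𝓡 2) f N ∧
          ∀ p : M, WeightedSurface.weightedMeanCurvature (𝓡 2) α a f p (N p) = c) ∧
    (∀ (M : Type*) [TopologicalSpace M] [T2Space M] [CompactSpace M] [Nonempty M]
        [ChartedSpace (EuclideanHalfSpace 2) M] [IsManifold (𝓡∂ 2) ∞ M]
        (f : M → WeightedSurface.Space),
      WeightedSurface.IsSingularMinimal (𝓡∂ 2) α a f → ((𝓡∂ 2).boundary M).Nonempty) := by
  refine ⟨?_, ?_⟩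
  · intro M _ _ _ _ _ _
    rintro ⟨f, N, c, him, hN, hc⟩
    exact WeightedSurface.not_forall_weightedMeanCurvature_eq hα ha him hN c hc
  · intro M _ _ _ _ _ _ f hf
    exact hf.boundary_nonempty hα ha
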